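/- Let $\mathcal V$ be a measurable space of symbols with measurable diagonal (for instance a Polish space with its Borel $\sigma$-field), let $\nu$ be a diffuse probability measure on $\mathcal V$, let $\alpha>0$ and $\sigma\in(0,1)$. Let $P\sim\mathrm{NGGP}(\alpha,\sigma,\nu)$, i.e. $P$ is distributed as $\mu/\mu(\mathcal V)$, where $\mu$ is a completely random measure on $\mathcal V$ with $0<\mu(\mathcal V)<+\infty$ almost surely and with Lévy intensity measure $$\frac{\alpha 2^{\sigma-1}}{\Gamma(1-\sigma)}\,\xi^{-1-\sigma}\mathrm e^{-\xi/2}\,\mathrm d\xi\;\nu(\mathrm dv),\qquad \xi>0.$$ Let $m\ge 1$ and let $X_1,\dots,X_{m+1}$ be a random sample from $P$, i.e. conditionally on $P$ they are i.i.d. with law $P$. For $r\ge 0$ let $\mathbf v_r$ be the (random) set of the symbols $v\in\mathcal V$ that occur exactly $r$ times in $X_{1:m}=(X_1,\dots,X_m)$; thus $\mathbf v_0$ is the set of symbols not in $X_{1:m}$. Let $K_m$ be the number of distinct symbols in $X_{1:m}$ and, for $1\le r\le m$, let $M_{r,m}$ be the number of symbols in $\mathbf v_r$. Put $\mathbf M_m=(M_{1,m},\dots,M_{m,m})$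 and, for $k\ge1$, $$V_{m,k}=\frac{(\alpha2^{\sigma-1})^{k}}{\Gamma(m)}\int_{0}^{+\infty}\frac{x^{m-1}}{(2^{-1}+x)^{m-k\sigma}}\exp\Big\{-\frac{\alpha2^{\sigma-1}}{\sigma}\big[(2^{-1}+x)^{\sigma}-2^{-\sigma}\big]\Big\}\,\mathrm d x .$$ Then, almost surely, $$\Pr[X_{m+1}\in\mathbf v_0\mid X_{1:m}]=\frac{V_{m+1,K_m+1}}{V_{m,K_m}},\qquad \Pr[X_{m+1}\in\mathbf v_r\mid X_{1:m}]=(r-\sigma)\,M_{r,m}\,\frac{V_{m+1,K_m}}{V_{m,K_m}}\quad(1\le r\le m).$$ Moreover, for every $\mathbf m=(m_1,\dots,m_m)$ with $\Pr[\mathbf M_m=\mathbf m]>0$ and with $k=\sum_{r=1}^m m_r$, $$\Pr[X_{m+1}\in\mathbf v_0\mid \mathbf M_m=\mathbf m]=\frac{V_{m+1,k+1}}{V_{m,k}},\qquad \Pr[X_{m+1}\in\mathbf v_r\mid \mathbf M_m=\mathbf m]=(r-\sigma)\,m_r\,\frac{V_{m+1,k}}{V_{m,k}}\quad(1\le r\le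 m).$$ -/

import Mathlib

open MeasureTheory ProbabilityTheory Set
open scoped ENNReal

noncomputable section

/-- A completely random measure on `V`: a measurable map `μ` into the space of measures on `V`
whose values on pairwise disjoint measurable sets are mutually independent. -/
structure IsCRM {Ω V : Type*} [MeasurableSpace Ω] [MeasurableSpace V]
    (μ : Ω → Measure V) (Pr : Measure Ω) : Prop where
  measurable : Measurable μ
  indep : ∀ (n : ℕ) (A : Fin n → Set V), (∀ i, MeasurableSet (A i)) →
    Pairwise (fun i j => Disjoint (A i) (A j)) →
    iIndepFun (fun i ω => μ ω (A i)) Pr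

/-- Lévy--Khintchine representation of the random measure `μ` with Lévy intensity measure `γ`
on (jumps) × (locations): `E exp(-∫ f dμ) = exp(-∫ (1 - exp(-ξ f(v))) γ(dξ, dv))` for all
measurable `f ≥ 0` that are almost surely `μ`-integrable. -/
def HasLevyIntensity {Ω V : Type*} [MeasurableSpace Ω] [MeasurableSpace V]
    (μ : Ω → Measure V) (γ : Measure (ℝ × V)) (Pr : Measure Ω) : Prop :=
  ∀ f : V → ℝ, Measurable f → (∀ v, 0 ≤ f v) → (∀ᵐ ω ∂Pr, Integrable f (μ ω)) →
    ∫ ω, Real.exp (-∫ v, f v ∂(μ ω)) ∂Pr =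
      Real.exp (-∫ z, (1 - Real.exp (-(z.1 * f z.2))) ∂γ)

/-- The jump part of the Lévy intensity of the generalized gamma completely random measure:
`α 2^(σ-1) / Γ(1-σ) · ξ^(-1-σ) exp(-ξ/2) dξ` on `(0, ∞)`. -/
def genGammaJumps (α σ : ℝ) : Measure ℝ :=
  (volume.restrict (Ioi 0)).withDensity fun ξ =>
    ENNReal.ofReal
      (α * (2 : ℝ) ^ (σ - 1) / Real.Gamma (1 - σ) * ξ ^ (-1 - σ) * Real.exp (-ξ / 2))

/-- A generalized gamma completely random measure with base measure `ν`, with total mass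
almost surely in `(0, ∞)` so that it can be normalized. -/
structure IsGenGammaCRM {Ω V : Type*} [MeasurableSpace Ω] [MeasurableSpace V]
    (α σ : ℝ) (ν : Measure V) (μ : Ω → Measure V) (Pr : Measure Ω) : Prop where
  crm : IsCRM μ Pr
  levy : HasLevyIntensity μ ((genGammaJumps α σ).prod ν) Pr
  mass_pos_finite : ∀ᵐ ω ∂Pr, 0 < μ ω univ ∧ μ ω univ < ∞

/-- The normalization `μ / μ(V)` of a measure. -/
def normalizeMeasure {V : Type*} [MeasurableSpace V] (μ : Measure V) : Measure V :=
  (μ univ)⁻¹ • μ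

/-- `P ∼ NGGP(α, σ, ν)`: the law of the random measure `P` is the law of `μ / μ(V)` for a
generalized gamma completely random measure `μ`. The measure `κ` is the law of `μ`, and `μ` is
realized on the canonical space as the identity map. -/
structure IsNGGP {Ω V : Type*} [MeasurableSpace Ω] [MeasurableSpace V]
    (α σ : ℝ) (ν : Measure V) (P : Ω → Measure V) (Pr : Measure Ω) : Prop where
  measurable : Measurable P
  law : ∃ κ : Measure (Measure V), IsProbabilityMeasure κ ∧
    IsGenGammaCRM α σ ν (fun μ : Measure V => μ) κ ∧
    Pr.map P = κ.map normalizeMeasure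

/-- `X 0, …, X (n-1)` is a random sample of size `n` from the random probability measure `P`:
given `P`, the `X i` are independent and identically distributed with law `P`. -/
structure IsSampleFrom {Ω V : Type*} [MeasurableSpace Ω] [MeasurableSpace V] {n : ℕ}
    (X : Fin n → Ω → V) (P : Ω → Measure V) (Pr : Measure Ω) : Prop where
  measurable : ∀ i, Measurable (X i)
  cond_iid : ∀ (B : Set (Measure V)) (A : Fin n → Set V), MeasurableSet B →
    (∀ i, MeasurableSet (A i)) →
    Pr ({ω | P ω ∈ B} ∩ {ω | ∀ i, X i ω ∈ A i}) =
      ∫⁻ ω in {ω | P ω ∈ B}, ∏ i, P ω (A i) ∂Pr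

/-- The frequency of the symbol `v` in the data `x`. -/
def symbolFreq {V : Type*} {m : ℕ} (x : Fin m → V) (v : V) : ℕ :=
  Set.ncard {i | x i = v}

/-- The set `v_r` of symbols that occur exactly `r` times in the data `x`; for `r = 0` this is
the set of the symbols that do not occur in `x`. -/
def symbolsOfFreq {V : Type*} {m : ℕ} (x : Fin m → V) (r : ℕ) : Set V :=
  {v | symbolFreq x v = r}

/-- The number `K_m` of distinct symbols in the data `x`. -/
def numDistinct {V : Type*} {m : ℕ} (x : Fin m → V) : ℕ :=
  (Set.range x).ncard

/-- The number `M_{r,m}` of distinct symbols with frequency `r ≥ 1` in the data `x`. -/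
def freqCount {V : Type*} {m : ℕ} (x : Fin m → V) (r : ℕ) : ℕ :=
  (symbolsOfFreq x r).ncard

/-- The weights `V_{m,k}`. -/
def nggpWeight (α σ : ℝ) (m k : ℕ) : ℝ :=
  (α * (2 : ℝ) ^ (σ - 1)) ^ k / Real.Gamma m *
    ∫ x in Ioi (0 : ℝ),
      x ^ ((m : ℝ) - 1) / (1 / 2 + x) ^ ((m : ℝ) - k * σ) *
        Real.exp (-(α * (2 : ℝ) ^ (σ - 1) / σ * ((1 / 2 + x) ^ σ - (2 : ℝ) ^ (-σ))))

end

/-!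
The proof computes the law of a sample and reads off the predictive probabilities.

Write `a = α 2 ^ (σ - 1)`. Consider the urn whose `n`-th unnormalized predictive kernel is
`a ν + ∑ i, e_i(x) δ_{x i}`, where `e_i(x)` is `1 - σ` if `x i` is the first occurrence of its
symbol and `1` if it is a repetition (`discount`), so that a symbol of frequency `f` has the weight
`f - σ`. Let `Λ_n` be the finite measure of `n` draws (`urnMeasure`). The heart of the proof is the
formula (`laplaceMoment_eq`)

`E[exp(-∫ g dμ) ∏ i, μ (A i)] =`
`  exp(-ψ(g)) ∫_{A 0 × ⋯ × A (n-1)} ∏ i, (1/2 + g(x i)) ^ (-e_i(x)) Λ_n(dx)`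

for bounded measurable `g` that are bounded away from `0`, where `ψ` is the Laplace exponent. For
`n = 0` it is the Lévy--Khintchine representation, made explicit by a Gamma integral
(`integral_exp_neg_of_isGenGammaCRM`). For the induction step, `g` is replaced by `g + t 1_B`, and
both sides are differentiated at `t = 0`: on the left this brings down the factor `-μ B`
(`hasDerivAt_laplaceMoment`). On the right the derivative of `ψ` yields the term `a ν` of the
kernel and the derivative of the product yields the atoms (`hasDerivAt_exp_mul_boxIntegral`), which
is the recursion for `Λ_{n+1}`. This replaces the sum over set partitions of the classical
argument.

Taking `g` constant and integrating it out by `T ^ (-n) = Γ(n)⁻¹ ∫ u ^ (n - 1) exp(-u T) du`, where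
`T` is the total mass, shows that the law of a sample of size `n` is `a ^ (-K) V_{n,K} Λ_n`, where
`K` is the number of distinct symbols (`map_sample_eq_withDensity`). As `Λ_{m+1}` is built from
`Λ_m` and the urn kernel, the joint law of the data and of the frequency of the next draw follows
(`measure_data_inter_next`): the diffuse part of the kernel produces a new symbol, and the symbols
of frequency `r` carry the total weight `(r - σ) M_{r,m}`. Dividing by the density of the data
gives the conditional probabilities given the data. They depend on the data only through the
frequency counts, so they are constant on the event that these counts are prescribed.
-/

/-! ### Counting distinct symbols -/

section Counting

variable {V : Type*} {n : ℕ}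

open Classical in
theorem symbolFreq_eq_card (x : Fin n → V) (v : V) :
    symbolFreq x v = (Finset.univ.filter fun i => x i = v).card := by
  rw [symbolFreq, ← Set.ncard_coe_finset]
  congr 1
  ext i
  simp

theorem symbolFreq_eq_zero_iff (x : Fin n → V) (v : V) :
    symbolFreq x v = 0 ↔ v ∉ Set.range x := by
  classical
  simp [symbolFreq_eq_card, Finset.filter_eq_empty_iff]

open Classical in
theorem numDistinct_eq_card (x : Fin n → V) :
    numDistinct x = (Finset.univ.image x).card := by
  rw [numDistinct, ← Set.ncard_coe_finset]
  simp

open Classical in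
theorem freqCount_eq_card (x : Fin n → V) {r : ℕ} (hr : 1 ≤ r) :
    freqCount x r = ((Finset.univ.image x).filter fun v => symbolFreq x v = r).card := by
  rw [freqCount, ← Set.ncard_coe_finset]
  congr 1
  ext v
  simp only [symbolsOfFreq, Set.mem_ofPred_eq, Finset.coe_filter, Finset.mem_image, Finset.mem_univ,
    true_and]
  refine ⟨fun h => ⟨?_, h⟩, fun h => h.2⟩
  by_contra hv
  have : symbolFreq x v = 0 := (symbolFreq_eq_zero_iff x v).2 hv
  omega

/-- Each symbol of the data is counted once, at its first occurrence. -/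
theorem card_filter_first_occurrence (x : Fin n → V) (p : V → Prop) [DecidablePred p]
    [DecidableEq V] :
    (Finset.univ.filter fun i => (¬ ∃ j < i, x j = x i) ∧ p (x i)).card =
      ((Finset.univ.image x).filter p).card := by
  classical
  rw [← Finset.card_image_of_injOn (f := x) (s := Finset.univ.filter _)]
  · congr 1
    ext v
    simp only [Finset.mem_image, Finset.mem_filter, Finset.mem_univ, true_and]
    constructor
    · rintro ⟨i, ⟨-, hp⟩, rfl⟩
      exact ⟨⟨i, rfl⟩, hp⟩
    · rintro ⟨⟨i, rfl⟩, hp⟩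
      have hne : (Finset.univ.filter fun j => x j = x i).Nonempty := ⟨i, by simp⟩
      refine ⟨(Finset.univ.filter fun j => x j = x i).min' hne, ?_⟩
      have hmin := Finset.min'_mem _ hne
      simp only [Finset.mem_filter, Finset.mem_univ, true_and] at hmin
      refine ⟨⟨?_, hmin.symm ▸ hp⟩, hmin⟩
      rintro ⟨j, hj, hjx⟩
      exact absurd (Finset.min'_le _ j (by simp [hjx, hmin])) (not_le.2 hj)
  · intro i hi j hj hij
    simp only [Finset.coe_filter, Finset.mem_univ, true_and, Set.mem_ofPred_eq] at hi hj
    rcases lt_trichotomy i j with h | h | h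
    · exact absurd ⟨i, h, hij⟩ hj.1
    · exact h
    · exact absurd ⟨j, h, hij.symm⟩ hi.1

theorem numDistinct_eq_sum_freqCount (x : Fin n → V) :
    numDistinct x = ∑ r ∈ Finset.Icc 1 n, freqCount x r := by
  classical
  rw [numDistinct_eq_card, Finset.card_eq_sum_card_fiberwise (f := symbolFreq x)
    (t := Finset.Icc 1 n)]
  · refine Finset.sum_congr rfl fun r hr => ?_
    rw [freqCount_eq_card x (Finset.mem_Icc.1 hr).1]
  · intro v hv
    simp only [Finset.coe_image, Finset.coe_univ, Set.image_univ] at hv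
    simp only [Finset.coe_Icc, Set.mem_Icc]
    constructor
    · have : symbolFreq x v ≠ 0 := fun h => (symbolFreq_eq_zero_iff x v).1 h hv
      omega
    · rw [symbolFreq_eq_card]
      exact (Finset.card_le_univ _).trans (by simp)

theorem range_snoc (x : Fin n → V) (y : V) :
    Set.range (Fin.snoc x y : Fin (n + 1) → V) = insert y (Set.range x) := by
  ext v
  simp [eq_comm]

theorem numDistinct_snoc_of_mem (x : Fin n → V) {y : V} (hy : y ∈ Set.range x) :
    numDistinct (Fin.snoc x y : Fin (n + 1) → V) = numDistinct x := by
  rw [numDistinct, range_snoc, Set.insert_eq_of_mem hy, numDistinct]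

theorem numDistinct_snoc_of_notMem (x : Fin n → V) {y : V} (hy : y ∉ Set.range x) :
    numDistinct (Fin.snoc x y : Fin (n + 1) → V) = numDistinct x + 1 := by
  rw [numDistinct, range_snoc, Set.ncard_insert_of_notMem hy (Set.finite_range x), numDistinct]

open Classical in
/-- The weight with which the `i`-th observation attracts the next one: `1 - σ` at the first
occurrence of a symbol and `1` at a repetition. A symbol of frequency `r` collects the total
weight `r - σ`. -/
noncomputable def discount (σ : ℝ) (x : Fin n → V) (i : Fin n) : ℝ :=
  if ∃ j < i, x j = x i then 1 else 1 - σ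

theorem discount_pos {σ : ℝ} (hσ : σ < 1) (x : Fin n → V) (i : Fin n) : 0 < discount σ x i := by
  unfold discount
  split_ifs <;> linarith

theorem discount_le_one {σ : ℝ} (hσ : 0 ≤ σ) (x : Fin n → V) (i : Fin n) : discount σ x i ≤ 1 := by
  unfold discount
  split_ifs <;> linarith

theorem discount_snoc_castSucc (σ : ℝ) (x : Fin n → V) (y : V) (i : Fin n) :
    discount σ (Fin.snoc x y : Fin (n + 1) → V) i.castSucc = discount σ x i := by
  have h : (∃ j < i.castSucc, (Fin.snoc x y : Fin (n + 1) → V) j =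
      (Fin.snoc x y : Fin (n + 1) → V) i.castSucc) ↔ ∃ j < i, x j = x i := by
    rw [Fin.exists_fin_succ']
    simp [not_lt.2 (Fin.le_last _)]
  by_cases hx : ∃ j < i, x j = x i
  · exact (if_pos (h.2 hx)).trans (if_pos hx).symm
  · exact (if_neg fun h' => hx (h.1 h')).trans (if_neg hx).symm

theorem discount_snoc_last_of_mem (σ : ℝ) (x : Fin n → V) {y : V} (hy : y ∈ Set.range x) :
    discount σ (Fin.snoc x y : Fin (n + 1) → V) (Fin.last n) = 1 := by
  obtain ⟨i, rfl⟩ := hy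
  exact if_pos ⟨i.castSucc, Fin.castSucc_lt_last i, by simp⟩

theorem discount_snoc_last_of_notMem (σ : ℝ) (x : Fin n → V) {y : V} (hy : y ∉ Set.range x) :
    discount σ (Fin.snoc x y : Fin (n + 1) → V) (Fin.last n) = 1 - σ := by
  refine if_neg ?_
  rintro ⟨j, hj, h⟩
  refine hy ⟨j.castLT hj, ?_⟩
  rw [Fin.snoc_last] at h
  rw [← h]
  conv_rhs => rw [← Fin.castSucc_castLT j hj, Fin.snoc_castSucc]

theorem sum_discount_filter [DecidableEq V] (σ : ℝ) (x : Fin n → V) (p : V → Prop)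
    [DecidablePred p] :
    ∑ i, (if p (x i) then discount σ x i else 0) =
      ((Finset.univ.filter fun i => p (x i)).card : ℝ) -
        σ * ((Finset.univ.image x).filter p).card := by
  classical
  rw [← card_filter_first_occurrence, Finset.card_filter, Finset.card_filter, Nat.cast_sum,
    Nat.cast_sum, Finset.mul_sum, ← Finset.sum_sub_distrib]
  refine Finset.sum_congr rfl fun i _ => ?_
  unfold discount
  by_cases h1 : p (x i) <;> by_cases h2 : ∃ j < i, x j = x i <;> simp [h1, h2]

theorem sum_discount (σ : ℝ) (x : Fin n → V) :
    ∑ i, discount σ x i = n - σ * numDistinct x := by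
  classical
  have := sum_discount_filter σ x (fun _ => True)
  simpa [numDistinct_eq_card] using this

open Classical in
theorem sum_discount_freq (σ : ℝ) (x : Fin n → V) {r : ℕ} (hr : 1 ≤ r) :
    ∑ i, (if symbolFreq x (x i) = r then discount σ x i else 0) =
      ((r : ℝ) - σ) * freqCount x r := by
  rw [sum_discount_filter σ x (fun v => symbolFreq x v = r), freqCount_eq_card x hr, sub_mul]
  congr 1
  rw [Finset.card_eq_sum_card_fiberwise (f := x)
    (t := (Finset.univ.image x).filter fun v => symbolFreq x v = r)
    (fun i hi => by simpa using hi), Finset.sum_const_nat (m := r), mul_comm]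
  · push_cast; rfl
  · intro v hv
    obtain ⟨-, hv⟩ := Finset.mem_filter.1 hv
    conv_rhs => rw [← hv, symbolFreq_eq_card]
    congr 1
    ext i
    simp only [Finset.mem_filter, Finset.mem_univ, true_and]
    constructor
    · exact fun h => h.2
    · rintro rfl
      exact ⟨hv, rfl⟩

end Counting

/-! ### Measurability of the counts -/

section Measurability

variable {V : Type*} [MeasurableSpace V] [MeasurableEq V] {n : ℕ}

theorem measurableSet_exists_lt_eq (i : Fin n) :
    MeasurableSet {x : Fin n → V | ∃ j < i, x j = x i} := by
  have : {x : Fin n → V | ∃ j < i, x j = x i} = ⋃ j, ⋃ (_ : j < i), {x | x j = x i} := by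
    ext x; simp
  rw [this]
  exact MeasurableSet.iUnion fun j => MeasurableSet.iUnion fun _ =>
    measurableSet_eq_fun (measurable_pi_apply j) (measurable_pi_apply i)

theorem measurable_discount (σ : ℝ) (i : Fin n) :
    Measurable fun x : Fin n → V => discount σ x i :=
  Measurable.ite (measurableSet_exists_lt_eq i) measurable_const measurable_const

theorem measurable_symbolFreq : Measurable fun p : (Fin n → V) × V => symbolFreq p.1 p.2 := by
  classical
  simp only [symbolFreq_eq_card, Finset.card_filter]
  refine Finset.measurable_sum _ fun i _ => ?_
  exact Measurable.ite (measurableSet_eq_fun (by fun_prop) (by fun_prop)) measurable_const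
    measurable_const

theorem measurable_numDistinct : Measurable fun x : Fin n → V => numDistinct x := by
  classical
  have h : ∀ x : Fin n → V, numDistinct x = ∑ i, if ∃ j < i, x j = x i then 0 else 1 := by
    intro x
    have := card_filter_first_occurrence x (fun _ => True)
    rw [numDistinct_eq_card]
    simp only [and_true, Finset.filter_true] at this
    rw [← this, Finset.card_filter]
    exact Finset.sum_congr rfl fun i _ => by split_ifs <;> simp_all
  simp only [h]
  exact Finset.measurable_sum _ fun i _ =>
    Measurable.ite (measurableSet_exists_lt_eq i) measurable_const measurable_const

theorem measurable_comp_numDistinct {β : Type*} [MeasurableSpace β] (f : ℕ → β) :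
    Measurable fun x : Fin n → V => f (numDistinct x) :=
  measurable_from_nat.comp measurable_numDistinct

theorem measurable_freqCount {r : ℕ} (hr : 1 ≤ r) :
    Measurable fun x : Fin n → V => freqCount x r := by
  classical
  have h : ∀ x : Fin n → V, freqCount x r =
      ∑ i, if (∃ j < i, x j = x i) then 0 else if symbolFreq x (x i) = r then 1 else 0 := by
    intro x
    rw [freqCount_eq_card x hr, ← card_filter_first_occurrence, Finset.card_filter]
    exact Finset.sum_congr rfl fun i _ => by split_ifs <;> simp_all
  simp only [h]
  refine Finset.measurable_sum _ fun i _ => Measurable.ite (measurableSet_exists_lt_eq i)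
    measurable_const (Measurable.ite ?_ measurable_const measurable_const)
  exact measurableSet_eq_fun
    (measurable_symbolFreq.comp (measurable_id.prodMk (measurable_pi_apply i))) measurable_const

theorem measurable_snoc {V : Type*} [MeasurableSpace V] {n : ℕ} :
    Measurable fun p : (Fin n → V) × V => (Fin.snoc p.1 p.2 : Fin (n + 1) → V) := by
  refine measurable_pi_lambda _ fun i => ?_
  refine Fin.lastCases ?_ (fun j => ?_) i
  · simpa using measurable_snd
  · simp only [Fin.snoc_castSucc]
    fun_prop

end Measurability

/-! ### The urn measure -/

section Urn

variable {V : Type*} [MeasurableSpace V] [MeasurableEq V]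

/-- The unnormalized predictive kernel `a ν + ∑ i, discount σ x i • δ_{x i}`. -/
noncomputable def urnKernel (a σ : ℝ) (ν : Measure V) (n : ℕ) : Kernel (Fin n → V) V where
  toFun x := ENNReal.ofReal a • ν + ∑ i, ENNReal.ofReal (discount σ x i) • Measure.dirac (x i)
  measurable' := by
    refine Measure.measurable_of_measurable_coe _ fun s hs => ?_
    simp only [Measure.add_apply, Measure.smul_apply, Measure.finsetSum_apply, smul_eq_mul,
      Measure.dirac_apply' _ hs]
    refine measurable_const.add (Finset.measurable_sum _ fun i _ => ?_)
    exact (measurable_discount σ i).ennreal_ofReal.mul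
      ((measurable_one.indicator hs).comp (measurable_pi_apply i))

theorem lintegral_urnKernel (a σ : ℝ) (ν : Measure V) {n : ℕ} (x : Fin n → V) (f : V → ℝ≥0∞) :
    ∫⁻ y, f y ∂(urnKernel a σ ν n x) =
      ENNReal.ofReal a * ∫⁻ y, f y ∂ν + ∑ i, ENNReal.ofReal (discount σ x i) * f (x i) := by
  change ∫⁻ y, f y ∂(ENNReal.ofReal a • ν +
    ∑ i, ENNReal.ofReal (discount σ x i) • Measure.dirac (x i)) = _
  simp only [lintegral_add_measure, lintegral_finsetSum_measure, lintegral_smul_measure,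
    lintegral_dirac, smul_eq_mul]

instance (a σ : ℝ) (ν : Measure V) [IsFiniteMeasure ν] (n : ℕ) :
    IsFiniteKernel (urnKernel a σ ν n) := by
  refine ⟨⟨ENNReal.ofReal a * ν univ + n * ENNReal.ofReal (1 + |σ|), ?_, fun x => ?_⟩⟩
  · exact ENNReal.add_lt_top.2 ⟨ENNReal.mul_lt_top ENNReal.ofReal_lt_top (measure_lt_top _ _),
      ENNReal.mul_lt_top (by simp) ENNReal.ofReal_lt_top⟩
  · rw [← setLIntegral_one, Measure.restrict_univ, lintegral_urnKernel]
    simp only [lintegral_one, mul_one]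
    gcongr
    refine (Finset.sum_le_card_nsmul _ _ (ENNReal.ofReal (1 + |σ|)) fun i _ => ?_).trans (by simp)
    refine ENNReal.ofReal_le_ofReal ?_
    unfold discount
    have := neg_abs_le σ
    split_ifs <;> linarith [abs_nonneg σ]

/-- The unnormalized law of `n` successive draws from the urn with kernels `urnKernel a σ ν`.
It is the finite measure with respect to which the law of a sample of size `n` has a density that
depends on the number of distinct symbols only. -/
noncomputable def urnMeasure (a σ : ℝ) (ν : Measure V) : (n : ℕ) → Measure (Fin n → V)
  | 0 => Measure.dirac Fin.elim0
  | n + 1 => (urnMeasure a σ ν n ⊗ₘ urnKernel a σ ν n).map fun p => Fin.snoc p.1 p.2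

instance isFiniteMeasure_urnMeasure (a σ : ℝ) (ν : Measure V) [IsFiniteMeasure ν] (n : ℕ) :
    IsFiniteMeasure (urnMeasure a σ ν n) := by
  induction n with
  | zero => unfold urnMeasure; infer_instance
  | succ n ih => unfold urnMeasure; infer_instance

theorem lintegral_urnMeasure_succ (a σ : ℝ) (ν : Measure V) [IsFiniteMeasure ν] (n : ℕ)
    {f : (Fin (n + 1) → V) → ℝ≥0∞} (hf : Measurable f) :
    ∫⁻ z, f z ∂(urnMeasure a σ ν (n + 1)) =
      ∫⁻ x, (ENNReal.ofReal a * ∫⁻ y, f (Fin.snoc x y) ∂ν +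
        ∑ i, ENNReal.ofReal (discount σ x i) * f (Fin.snoc x (x i))) ∂(urnMeasure a σ ν n) := by
  rw [urnMeasure, lintegral_map hf measurable_snoc,
    Measure.lintegral_compProd (f := fun p => f (Fin.snoc p.1 p.2)) (hf.comp measurable_snoc)]
  simp only [lintegral_urnKernel]

end Urn

/-! ### Exponentially tilted weights on the urn measure -/

section Weights

variable {V : Type*}

/-- The indicator function of the box `A 0 × ⋯ × A (n-1)`, as a product. -/
noncomputable def boxIndicator {n : ℕ} (A : Fin n → Set V) (x : Fin n → V) : ℝ :=
  ∏ i, (A i).indicator 1 (x i)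

theorem indicator_one_nonneg (B : Set V) (v : V) : 0 ≤ B.indicator (1 : V → ℝ) v :=
  Set.indicator_nonneg (fun _ _ => zero_le_one) v

theorem indicator_one_le_one (B : Set V) (v : V) : B.indicator (1 : V → ℝ) v ≤ 1 :=
  Set.indicator_le_self' (fun _ _ => zero_le_one) v

theorem boxIndicator_nonneg {n : ℕ} (A : Fin n → Set V) (x : Fin n → V) :
    0 ≤ boxIndicator A x :=
  Finset.prod_nonneg fun i _ => indicator_one_nonneg (A i) (x i)

theorem boxIndicator_le_one {n : ℕ} (A : Fin n → Set V) (x : Fin n → V) :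
    boxIndicator A x ≤ 1 :=
  Finset.prod_le_one (fun i _ => indicator_one_nonneg (A i) (x i))
    fun i _ => indicator_one_le_one (A i) (x i)

theorem boxIndicator_snoc {n : ℕ} (A : Fin (n + 1) → Set V) (x : Fin n → V) (y : V) :
    boxIndicator A (Fin.snoc x y) =
      boxIndicator (fun i => A i.castSucc) x * (A (Fin.last n)).indicator 1 y := by
  simp [boxIndicator, Fin.prod_univ_castSucc]

theorem measurable_boxIndicator [MeasurableSpace V] {n : ℕ} {A : Fin n → Set V}
    (hA : ∀ i, MeasurableSet (A i)) : Measurable (boxIndicator A) :=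
  Finset.measurable_prod _ fun i _ =>
    (measurable_one.indicator (hA i)).comp (measurable_pi_apply i)

/-- The weight `∏ v, (1/2 + g v) ^ (σ - f_v)` over the distinct symbols `v` of `x`, where `f_v` is
the frequency of `v`, written as a product over the observations. -/
noncomputable def urnWeight (σ : ℝ) (g : V → ℝ) {n : ℕ} (x : Fin n → V) : ℝ :=
  Real.exp (-∑ i, discount σ x i * Real.log (1 / 2 + g (x i)))

theorem urnWeight_pos (σ : ℝ) (g : V → ℝ) {n : ℕ} (x : Fin n → V) : 0 < urnWeight σ g x :=
  Real.exp_pos _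

theorem urnWeight_snoc_of_mem (σ : ℝ) {g : V → ℝ} (hg : ∀ v, 0 ≤ g v) {n : ℕ} (x : Fin n → V)
    {y : V} (hy : y ∈ Set.range x) :
    urnWeight σ g (Fin.snoc x y : Fin (n + 1) → V) = urnWeight σ g x * (1 / 2 + g y)⁻¹ := by
  have hpos : 0 < 1 / 2 + g y := by linarith [hg y]
  rw [urnWeight, Fin.sum_univ_castSucc, neg_add, Real.exp_add, discount_snoc_last_of_mem σ x hy]
  simp only [discount_snoc_castSucc, Fin.snoc_castSucc, Fin.snoc_last, one_mul]
  rw [Real.exp_neg (Real.log _), Real.exp_log hpos, urnWeight]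

theorem urnWeight_snoc_of_notMem (σ : ℝ) {g : V → ℝ} (hg : ∀ v, 0 ≤ g v) {n : ℕ} (x : Fin n → V)
    {y : V} (hy : y ∉ Set.range x) :
    urnWeight σ g (Fin.snoc x y : Fin (n + 1) → V) =
      urnWeight σ g x * (1 / 2 + g y) ^ (σ - 1) := by
  have hpos : 0 < 1 / 2 + g y := by linarith [hg y]
  rw [urnWeight, Fin.sum_univ_castSucc, neg_add, Real.exp_add,
    discount_snoc_last_of_notMem σ x hy]
  simp only [discount_snoc_castSucc, Fin.snoc_castSucc, Fin.snoc_last]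
  rw [Real.rpow_def_of_pos hpos, urnWeight]
  congr 2
  ring

theorem urnWeight_const (σ : ℝ) {u : ℝ} (hu : 0 ≤ u) {n : ℕ} (x : Fin n → V) :
    urnWeight σ (fun _ => u) x = (1 / 2 + u) ^ (-((n : ℝ) - numDistinct x * σ)) := by
  have hpos : 0 < 1 / 2 + u := by linarith
  rw [urnWeight, Real.rpow_def_of_pos hpos, ← Finset.sum_mul, sum_discount]
  congr 1
  ring

theorem urnWeight_le {σ : ℝ} (hσ0 : 0 ≤ σ) (hσ1 : σ < 1) {g : V → ℝ} (hg : ∀ v, 0 ≤ g v) {n : ℕ}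
    (x : Fin n → V) : urnWeight σ g x ≤ 2 ^ n := by
  have hlog : ∀ i, -Real.log 2 ≤ discount σ x i * Real.log (1 / 2 + g (x i)) := by
    intro i
    have h1 : -Real.log 2 ≤ Real.log (1 / 2 + g (x i)) := by
      rw [← Real.log_inv]
      exact Real.log_le_log (by norm_num) (by linarith [hg (x i)])
    have h2 : 0 < Real.log 2 := Real.log_pos one_lt_two
    nlinarith [discount_pos hσ1 x i, discount_le_one hσ0 x i]
  have h : -∑ i, discount σ x i * Real.log (1 / 2 + g (x i)) ≤ n * Real.log 2 := by
    have := Finset.sum_le_sum fun i (_ : i ∈ Finset.univ) => hlog i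
    simp only [Finset.sum_const, Finset.card_univ, Fintype.card_fin, nsmul_eq_mul] at this
    linarith
  calc urnWeight σ g x ≤ Real.exp (n * Real.log 2) := Real.exp_le_exp.2 h
    _ = 2 ^ n := by rw [Real.exp_nat_mul, Real.exp_log two_pos]

variable [MeasurableSpace V] [MeasurableEq V]

theorem measurable_urnWeight (σ : ℝ) {g : V → ℝ} (hg : Measurable g) {n : ℕ} :
    Measurable fun x : Fin n → V => urnWeight σ g x := by
  refine Real.measurable_exp.comp (Measurable.neg (Finset.measurable_sum _ fun i _ => ?_))
  refine (measurable_discount σ i).mul (Real.measurable_log.comp (measurable_const.add ?_))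
  exact hg.comp (measurable_pi_apply i)

/-- The integral of the weight `urnWeight σ g` over a box with respect to the urn measure. -/
noncomputable def boxIntegral (a σ : ℝ) (ν : Measure V) {n : ℕ} (A : Fin n → Set V) (g : V → ℝ) :
    ℝ :=
  ∫ x, boxIndicator A x * urnWeight σ g x ∂(urnMeasure a σ ν n)

theorem boxIntegral_succ {a σ : ℝ} (ha : 0 ≤ a) (hσ1 : σ < 1) (ν : Measure V)
    [IsProbabilityMeasure ν] [NullSingletonClass ν] {n : ℕ} {A : Fin (n + 1) → Set V}
    (hA : ∀ i, MeasurableSet (A i)) {g : V → ℝ} (hg : Measurable g) (hg0 : ∀ v, 0 ≤ g v) :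
    boxIntegral a σ ν A g =
      ∫ x, boxIndicator (fun i => A i.castSucc) x * urnWeight σ g x *
        (a * ∫ y, (A (Fin.last n)).indicator 1 y * (1 / 2 + g y) ^ (σ - 1) ∂ν +
          ∑ i, discount σ x i * ((A (Fin.last n)).indicator 1 (x i) * (1 / 2 + g (x i))⁻¹))
        ∂(urnMeasure a σ ν n) := by
  have hpos : ∀ v, 0 < 1 / 2 + g v := fun v => by linarith [hg0 v]
  have hI : ∀ v, 0 ≤ (A (Fin.last n)).indicator (1 : V → ℝ) v := indicator_one_nonneg _
  have hmI : Measurable ((A (Fin.last n)).indicator (1 : V → ℝ)) :=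
    measurable_one.indicator (hA _)
  have hbdd : ∀ v, (A (Fin.last n)).indicator 1 v * (1 / 2 + g v) ^ (σ - 1) ≤
      (1 / 2 : ℝ) ^ (σ - 1) := by
    intro v
    have h1 : (1 / 2 + g v) ^ (σ - 1) ≤ (1 / 2 : ℝ) ^ (σ - 1) :=
      Real.rpow_le_rpow_of_nonpos (by norm_num) (by linarith [hg0 v]) (by linarith)
    have h2 : 0 ≤ (1 / 2 + g v) ^ (σ - 1) := (Real.rpow_pos_of_pos (hpos v) _).le
    nlinarith [hI v, indicator_one_le_one (A (Fin.last n)) v]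
  have hmB : Measurable fun y => (A (Fin.last n)).indicator 1 y * (1 / 2 + g y) ^ (σ - 1) :=
    hmI.mul ((measurable_const.add hg).pow_const _)
  have hintB : Integrable (fun y => (A (Fin.last n)).indicator 1 y * (1 / 2 + g y) ^ (σ - 1)) ν :=
    Integrable.of_bound hmB.aestronglyMeasurable ((1 / 2 : ℝ) ^ (σ - 1)) <|
      Filter.Eventually.of_forall fun v => by
        rw [Real.norm_of_nonneg (mul_nonneg (hI v) (Real.rpow_pos_of_pos (hpos v) _).le)]
        exact hbdd v
  have hW : ∀ x : Fin n → V, 0 ≤ boxIndicator (fun i => A i.castSucc) x * urnWeight σ g x :=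
    fun x => mul_nonneg (boxIndicator_nonneg _ _) (urnWeight_pos _ _ _).le
  have hterm : ∀ (x : Fin n → V) i,
      0 ≤ discount σ x i * ((A (Fin.last n)).indicator 1 (x i) * (1 / 2 + g (x i))⁻¹) :=
    fun x i => mul_nonneg (discount_pos hσ1 x i).le
      (mul_nonneg (hI _) (inv_nonneg.2 (hpos _).le))
  have hB0 : 0 ≤ ∫ y, (A (Fin.last n)).indicator 1 y * (1 / 2 + g y) ^ (σ - 1) ∂ν :=
    integral_nonneg fun v => mul_nonneg (hI v) (Real.rpow_pos_of_pos (hpos v) _).le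
  rw [boxIntegral, integral_eq_lintegral_of_nonneg_ae, integral_eq_lintegral_of_nonneg_ae,
    lintegral_urnMeasure_succ]
  · congr 1
    refine lintegral_congr fun x => ?_
    have h1 : ∫⁻ y, ENNReal.ofReal (boxIndicator A (Fin.snoc x y) *
        urnWeight σ g (Fin.snoc x y : Fin (n + 1) → V)) ∂ν =
        ENNReal.ofReal (boxIndicator (fun i => A i.castSucc) x * urnWeight σ g x) *
          ENNReal.ofReal
            (∫ y, (A (Fin.last n)).indicator 1 y * (1 / 2 + g y) ^ (σ - 1) ∂ν) := by
      rw [ofReal_integral_eq_lintegral_ofReal hintB (Filter.Eventually.of_forall fun v =>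
        mul_nonneg (hI v) (Real.rpow_pos_of_pos (hpos v) _).le),
        ← lintegral_const_mul _ hmB.ennreal_ofReal]
      refine lintegral_congr_ae ?_
      -- a fresh symbol is almost surely different from the finitely many symbols of the data
      have hnew : ∀ᵐ y ∂ν, y ∉ Set.range x :=
        measure_eq_zero_iff_ae_notMem.1 ((Set.finite_range x).measure_zero ν)
      filter_upwards [hnew] with y hy
      rw [boxIndicator_snoc, urnWeight_snoc_of_notMem σ hg0 x hy, ← ENNReal.ofReal_mul (hW x)]
      congr 1
      ring
    rw [h1, ENNReal.ofReal_mul (hW x), ENNReal.ofReal_add (mul_nonneg ha hB0)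
      (Finset.sum_nonneg fun i _ => hterm x i), ENNReal.ofReal_mul ha,
      ENNReal.ofReal_sum_of_nonneg fun i _ => hterm x i, mul_add, Finset.mul_sum]
    congr 1
    · ring
    · refine Finset.sum_congr rfl fun i _ => ?_
      rw [boxIndicator_snoc, urnWeight_snoc_of_mem σ hg0 x ⟨i, rfl⟩,
        ← ENNReal.ofReal_mul (discount_pos hσ1 x i).le, ← ENNReal.ofReal_mul (hW x)]
      congr 1
      ring
  · exact ((measurable_boxIndicator hA).mul (measurable_urnWeight σ hg)).ennreal_ofReal
  · exact Filter.Eventually.of_forall fun x => mul_nonneg (hW x)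
      (add_nonneg (mul_nonneg ha hB0) (Finset.sum_nonneg fun i _ => hterm x i))
  · refine Measurable.aestronglyMeasurable (((measurable_boxIndicator fun i => hA _).mul
      (measurable_urnWeight σ hg)).mul (measurable_const.add
        (Finset.measurable_sum _ fun i _ => (measurable_discount σ i).mul ?_)))
    exact (hmI.comp (measurable_pi_apply i)).mul
      (measurable_const.add (hg.comp (measurable_pi_apply i))).inv
  · exact Filter.Eventually.of_forall fun x =>
      mul_nonneg (boxIndicator_nonneg _ _) (urnWeight_pos _ _ _).le
  · exact ((measurable_boxIndicator hA).mul (measurable_urnWeight σ hg)).aestronglyMeasurable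

end Weights

/-! ### Differentiating the tilted weights -/

section Derivative

variable {V : Type*} [MeasurableSpace V]

/-- The Laplace exponent `ψ(g) = (a / σ) ∫ ((1/2 + g)^σ - (1/2)^σ) dν` of the generalized gamma
completely random measure. -/
noncomputable def laplaceExponent (a σ : ℝ) (ν : Measure V) (g : V → ℝ) : ℝ :=
  ∫ v, a / σ * ((1 / 2 + g v) ^ σ - (1 / 2 : ℝ) ^ σ) ∂ν

theorem hasDerivAt_laplaceExponent {a σ : ℝ} (ha : 0 ≤ a) (hσ0 : 0 < σ) (hσ1 : σ < 1)
    (ν : Measure V) [IsProbabilityMeasure ν] {g : V → ℝ} (hg : Measurable g) {c C : ℝ} (hc : 0 < c)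
    (hcg : ∀ v, c ≤ g v) (hgC : ∀ v, g v ≤ C) {B : Set V} (hB : MeasurableSet B) :
    HasDerivAt (fun t => laplaceExponent a σ ν fun v => g v + t * B.indicator 1 v)
      (a * ∫ y, B.indicator 1 y * (1 / 2 + g y) ^ (σ - 1) ∂ν) 0 := by
  have hmI : Measurable (B.indicator (1 : V → ℝ)) := measurable_one.indicator hB
  -- on this ball the perturbed tilt stays nonnegative
  have hpos : ∀ v, ∀ t ∈ Metric.ball (0 : ℝ) c, 1 / 2 ≤ 1 / 2 + (g v + t * B.indicator 1 v) := by
    intro v t ht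
    rw [Metric.mem_ball, Real.dist_eq, sub_zero, abs_lt] at ht
    nlinarith [hcg v, indicator_one_nonneg B v, indicator_one_le_one B v, ht.1, ht.2]
  have key := (hasDerivAt_integral_of_dominated_loc_of_deriv_le (μ := ν) (x₀ := (0 : ℝ))
    (F := fun t v => a / σ * ((1 / 2 + (g v + t * B.indicator 1 v)) ^ σ - (1 / 2 : ℝ) ^ σ))
    (F' := fun t v => a * (B.indicator 1 v * (1 / 2 + (g v + t * B.indicator 1 v)) ^ (σ - 1)))
    (bound := fun _ => a * (1 / 2 : ℝ) ^ (σ - 1))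
    (Metric.ball_mem_nhds 0 hc) ?_ ?_ ?_ ?_ (integrable_const _) ?_).2
  · simp only [zero_mul, add_zero, integral_const_mul] at key
    simpa only [laplaceExponent, integral_const_mul] using key
  · refine Filter.Eventually.of_forall fun t => Measurable.aestronglyMeasurable ?_
    exact measurable_const.mul (((measurable_const.add
      (hg.add (measurable_const.mul hmI))).pow_const _).sub measurable_const)
  · refine Integrable.of_bound (C := a / σ * ((1 / 2 + C) ^ σ)) ?_ ?_
    · exact Measurable.aestronglyMeasurable (measurable_const.mul (((measurable_const.add
        (hg.add (measurable_const.mul hmI))).pow_const _).sub measurable_const))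
    · refine Filter.Eventually.of_forall fun v => ?_
      have h0 : 0 ≤ g v := hc.le.trans (hcg v)
      simp only [zero_mul, add_zero]
      have h1 : (1 / 2 : ℝ) ^ σ ≤ (1 / 2 + g v) ^ σ :=
        Real.rpow_le_rpow (by norm_num) (by linarith) hσ0.le
      have h2 : (1 / 2 + g v) ^ σ ≤ (1 / 2 + C) ^ σ :=
        Real.rpow_le_rpow (by linarith) (by linarith [hgC v]) hσ0.le
      have h3 : 0 ≤ (1 / 2 : ℝ) ^ σ := by positivity
      rw [Real.norm_of_nonneg (mul_nonneg (div_nonneg ha hσ0.le) (by linarith))]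
      gcongr
      linarith
  · refine Measurable.aestronglyMeasurable ?_
    exact measurable_const.mul (hmI.mul ((measurable_const.add
      (hg.add (measurable_const.mul hmI))).pow_const _))
  · refine Filter.Eventually.of_forall fun v t ht => ?_
    have h := hpos v t ht
    have h1 : (1 / 2 + (g v + t * B.indicator 1 v)) ^ (σ - 1) ≤ (1 / 2 : ℝ) ^ (σ - 1) :=
      Real.rpow_le_rpow_of_nonpos (by norm_num) h (by linarith)
    have h2 : 0 ≤ (1 / 2 + (g v + t * B.indicator 1 v)) ^ (σ - 1) :=
      Real.rpow_nonneg (by linarith) _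
    rw [Real.norm_of_nonneg (mul_nonneg ha (mul_nonneg (indicator_one_nonneg B v) h2))]
    refine mul_le_mul_of_nonneg_left ?_ ha
    nlinarith [indicator_one_nonneg B v, indicator_one_le_one B v]
  · refine Filter.Eventually.of_forall fun v t ht => ?_
    have h := hpos v t ht
    have hlin : HasDerivAt (fun s : ℝ => 1 / 2 + (g v + s * B.indicator 1 v))
        (B.indicator 1 v) t := by
      simpa using (((hasDerivAt_id t).mul_const (B.indicator 1 v)).const_add (g v)).const_add
        (1 / 2)
    have := ((hlin.rpow_const (p := σ) (Or.inl (by linarith))).sub_const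
      ((1 / 2 : ℝ) ^ σ)).const_mul (a / σ)
    refine this.congr_deriv ?_
    field_simp

variable [MeasurableEq V]

theorem hasDerivAt_boxIntegral {a σ : ℝ} (hσ0 : 0 < σ) (hσ1 : σ < 1)
    (ν : Measure V) [IsProbabilityMeasure ν] {n : ℕ} {A : Fin n → Set V}
    (hA : ∀ i, MeasurableSet (A i)) {g : V → ℝ} (hg : Measurable g) {c : ℝ} (hc : 0 < c)
    (hcg : ∀ v, c ≤ g v) {B : Set V} (hB : MeasurableSet B) :
    HasDerivAt (fun t => boxIntegral a σ ν A fun v => g v + t * B.indicator 1 v)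
      (-∫ x, boxIndicator A x * urnWeight σ g x *
        ∑ i, discount σ x i * (B.indicator 1 (x i) * (1 / 2 + g (x i))⁻¹)
          ∂(urnMeasure a σ ν n)) 0 ∧
    Integrable (fun x => boxIndicator A x * urnWeight σ g x *
        ∑ i, discount σ x i * (B.indicator 1 (x i) * (1 / 2 + g (x i))⁻¹)) (urnMeasure a σ ν n) ∧
    Integrable (fun x => boxIndicator A x * urnWeight σ g x) (urnMeasure a σ ν n) := by
  have hmI : Measurable (B.indicator (1 : V → ℝ)) := measurable_one.indicator hB
  -- on this ball the perturbed tilt stays nonnegative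
  have hnn : ∀ t ∈ Metric.ball (0 : ℝ) c, ∀ v, 0 ≤ g v + t * B.indicator 1 v := by
    intro t ht v
    rw [Metric.mem_ball, Real.dist_eq, sub_zero, abs_lt] at ht
    nlinarith [hcg v, indicator_one_nonneg B v, indicator_one_le_one B v, ht.1, ht.2]
  have hmg : ∀ t : ℝ, Measurable fun v => g v + t * B.indicator 1 v :=
    fun t => hg.add (measurable_const.mul hmI)
  have hm : ∀ t : ℝ, Measurable fun x : Fin n → V =>
      boxIndicator A x * urnWeight σ (fun v => g v + t * B.indicator 1 v) x :=
    fun t => (measurable_boxIndicator hA).mul (measurable_urnWeight σ (hmg t))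
  have hint : Integrable (fun x => boxIndicator A x *
      urnWeight σ (fun v => g v + (0 : ℝ) * B.indicator 1 v) x) (urnMeasure a σ ν n) := by
    refine Integrable.of_bound (hm 0).aestronglyMeasurable (2 ^ n)
      (Filter.Eventually.of_forall fun x => ?_)
    have h1 := urnWeight_le hσ0.le hσ1 (hnn 0 (Metric.mem_ball_self hc)) x
    have h2 := urnWeight_pos σ (fun v => g v + (0 : ℝ) * B.indicator 1 v) x
    rw [Real.norm_of_nonneg (mul_nonneg (boxIndicator_nonneg A x) h2.le)]
    nlinarith [boxIndicator_nonneg A x, boxIndicator_le_one A x]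
  have key := hasDerivAt_integral_of_dominated_loc_of_deriv_le (μ := urnMeasure a σ ν n)
    (x₀ := (0 : ℝ))
    (F := fun t x => boxIndicator A x * urnWeight σ (fun v => g v + t * B.indicator 1 v) x)
    (F' := fun t x => -(boxIndicator A x * urnWeight σ (fun v => g v + t * B.indicator 1 v) x *
      ∑ i, discount σ x i *
        (B.indicator 1 (x i) * (1 / 2 + (g (x i) + t * B.indicator 1 (x i)))⁻¹)))
    (bound := fun _ => 2 ^ n * (n * 2))
    (Metric.ball_mem_nhds 0 hc) ?_ hint ?_ ?_ (integrable_const _) ?_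
  · simp only [zero_mul, add_zero, integral_neg] at key hint
    refine ⟨key.2, ?_, hint⟩
    have := key.1.neg
    simpa only [Pi.neg_def, neg_neg] using this
  · exact Filter.Eventually.of_forall fun t => (hm t).aestronglyMeasurable
  · refine Measurable.aestronglyMeasurable (((hm 0).mul (Finset.measurable_sum _ fun i _ =>
      (measurable_discount σ i).mul ?_)).neg)
    exact (hmI.comp (measurable_pi_apply i)).mul
      (measurable_const.add ((hmg 0).comp (measurable_pi_apply i))).inv
  · refine Filter.Eventually.of_forall fun x t ht => ?_
    have h1 := urnWeight_le hσ0.le hσ1 (hnn t ht) x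
    have h2 := urnWeight_pos σ (fun v => g v + t * B.indicator 1 v) x
    have hinv : ∀ i, 0 ≤ (1 / 2 + (g (x i) + t * B.indicator 1 (x i)))⁻¹ ∧
        (1 / 2 + (g (x i) + t * B.indicator 1 (x i)))⁻¹ ≤ 2 := by
      intro i
      have := hnn t ht (x i)
      refine ⟨inv_nonneg.2 (by linarith), ?_⟩
      rw [inv_le_comm₀ (by linarith) two_pos]
      linarith
    have hterm : ∀ i, 0 ≤ discount σ x i *
        (B.indicator 1 (x i) * (1 / 2 + (g (x i) + t * B.indicator 1 (x i)))⁻¹) := fun i =>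
      mul_nonneg (discount_pos hσ1 x i).le (mul_nonneg (indicator_one_nonneg B _) (hinv i).1)
    have hsum : ∑ i, discount σ x i *
        (B.indicator 1 (x i) * (1 / 2 + (g (x i) + t * B.indicator 1 (x i)))⁻¹) ≤ n * 2 := by
      refine (Finset.sum_le_card_nsmul _ _ 2 fun i _ => ?_).trans (by simp)
      calc discount σ x i *
            (B.indicator 1 (x i) * (1 / 2 + (g (x i) + t * B.indicator 1 (x i)))⁻¹)
          ≤ 1 * (1 * 2) := by
            refine mul_le_mul (discount_le_one hσ0.le x i) ?_
              (mul_nonneg (indicator_one_nonneg B _) (hinv i).1) zero_le_one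
            exact mul_le_mul (indicator_one_le_one B _) (hinv i).2 (hinv i).1 zero_le_one
        _ = 2 := by norm_num
    rw [norm_neg, Real.norm_of_nonneg (mul_nonneg (mul_nonneg (boxIndicator_nonneg A x) h2.le)
      (Finset.sum_nonneg fun i _ => hterm i))]
    refine mul_le_mul ?_ hsum (Finset.sum_nonneg fun i _ => hterm i) (by positivity)
    nlinarith [boxIndicator_nonneg A x, boxIndicator_le_one A x]
  · refine Filter.Eventually.of_forall fun x t ht => ?_
    have hlin : ∀ i, HasDerivAt (fun s : ℝ => 1 / 2 + (g (x i) + s * B.indicator 1 (x i)))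
        (B.indicator 1 (x i)) t := fun i => by
      simpa using (((hasDerivAt_id t).mul_const (B.indicator 1 (x i))).const_add
        (g (x i))).const_add (1 / 2)
    have hs : HasDerivAt (fun s : ℝ => ∑ i, discount σ x i *
        Real.log (1 / 2 + (g (x i) + s * B.indicator 1 (x i))))
        (∑ i, discount σ x i * (B.indicator 1 (x i) /
          (1 / 2 + (g (x i) + t * B.indicator 1 (x i))))) t :=
      HasDerivAt.fun_sum fun i _ => ((hlin i).log (by linarith [hnn t ht (x i)])).const_mul _
    refine (hs.neg.exp.const_mul (boxIndicator A x)).congr_deriv ?_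
    simp only [urnWeight, div_eq_mul_inv]
    simp only [Pi.neg_apply]
    ring

/-- The recursion of the urn: differentiating the tilt along the last factor of the box `A` turns
the integral over the other factors into minus the integral over `A`. The derivative of the Laplace
exponent accounts for the diffuse part of the urn kernel and that of the weight for its atoms. -/
theorem hasDerivAt_exp_mul_boxIntegral {a σ : ℝ} (ha : 0 ≤ a) (hσ0 : 0 < σ) (hσ1 : σ < 1)
    (ν : Measure V) [IsProbabilityMeasure ν] [NullSingletonClass ν] {n : ℕ}
    {A : Fin (n + 1) → Set V} (hA : ∀ i, MeasurableSet (A i)) {g : V → ℝ} (hg : Measurable g)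
    {c C : ℝ} (hc : 0 < c) (hcg : ∀ v, c ≤ g v) (hgC : ∀ v, g v ≤ C) :
    HasDerivAt (fun t =>
        Real.exp (-laplaceExponent a σ ν fun v => g v + t * (A (Fin.last n)).indicator 1 v) *
          boxIntegral a σ ν (fun i => A i.castSucc)
            fun v => g v + t * (A (Fin.last n)).indicator 1 v)
      (-(Real.exp (-laplaceExponent a σ ν g) * boxIntegral a σ ν A g)) 0 := by
  obtain ⟨h1, h2, h3⟩ := hasDerivAt_boxIntegral (a := a) hσ0 hσ1 ν
    (A := fun i => A i.castSucc) (fun i => hA _) hg hc hcg (hA (Fin.last n))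
  have h4 := hasDerivAt_laplaceExponent ha hσ0 hσ1 ν hg hc hcg hgC (hA (Fin.last n))
  refine (h4.neg.exp.mul h1).congr_deriv ?_
  rw [boxIntegral_succ ha hσ1 ν hA hg fun v => hc.le.trans (hcg v)]
  simp only [mul_add, Pi.neg_apply, zero_mul, add_zero]
  rw [integral_add (h3.mul_const _) h2, integral_mul_const]
  simp only [boxIntegral]
  ring

end Derivative

/-! ### Exponentially tilted moments of a random measure -/

section Moments

theorem exp_neg_mul_mul_pow_le {c T : ℝ} (hc : 0 < c) (hT : 0 ≤ T) (k : ℕ) :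
    Real.exp (-(c * T)) * T ^ k ≤ k.factorial / c ^ k := by
  have h := Real.pow_div_factorial_le_exp (c * T) (mul_nonneg hc.le hT) k
  rw [div_le_iff₀ (by positivity), mul_pow] at h
  rw [Real.exp_neg, inv_mul_eq_div, div_le_div_iff₀ (Real.exp_pos _) (by positivity)]
  linarith

variable {V : Type*} [MeasurableSpace V]

theorem measurable_integral_of_nonneg {g : V → ℝ} (hg : Measurable g) (hg0 : ∀ v, 0 ≤ g v) :
    Measurable fun μ : Measure V => ∫ v, g v ∂μ := by
  have h : (fun μ : Measure V => ∫ v, g v ∂μ) =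
      fun μ => (∫⁻ v, ENNReal.ofReal (g v) ∂μ).toReal := by
    ext μ
    exact integral_eq_lintegral_of_nonneg_ae (Filter.Eventually.of_forall hg0)
      hg.aestronglyMeasurable
  rw [h]
  exact (Measure.measurable_lintegral hg.ennreal_ofReal).ennreal_toReal

/-- The moment `E[exp(-∫ g dμ) ∏ i, μ (A i)]` of the random measure with law `κ`. -/
noncomputable def laplaceMoment (κ : Measure (Measure V)) {n : ℕ} (A : Fin n → Set V)
    (g : V → ℝ) : ℝ :=
  ∫ μ, Real.exp (-∫ v, g v ∂μ) * ∏ i, μ.real (A i) ∂κ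

theorem measurable_laplaceMoment_integrand {n : ℕ} {A : Fin n → Set V}
    (hA : ∀ i, MeasurableSet (A i)) {g : V → ℝ} (hg : Measurable g) (hg0 : ∀ v, 0 ≤ g v) :
    Measurable fun μ : Measure V => Real.exp (-∫ v, g v ∂μ) * ∏ i, μ.real (A i) :=
  (measurable_integral_of_nonneg hg hg0).neg.exp.mul <| Finset.measurable_prod _ fun i _ =>
    (Measure.measurable_coe (hA i)).ennreal_toReal

theorem laplaceMoment_integrand_le {μ : Measure V} [IsFiniteMeasure μ] {n : ℕ}
    (A : Fin n → Set V) {g : V → ℝ} (hg : Integrable g μ) {c : ℝ} (hc : 0 < c)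
    (hcg : ∀ v, c ≤ g v) :
    Real.exp (-∫ v, g v ∂μ) * ∏ i, μ.real (A i) ≤ n.factorial / c ^ n := by
  refine le_trans ?_ (exp_neg_mul_mul_pow_le hc (measureReal_nonneg (μ := μ) (s := univ)) n)
  refine mul_le_mul ?_ ?_ (Finset.prod_nonneg fun i _ => measureReal_nonneg) (Real.exp_pos _).le
  · refine Real.exp_le_exp.2 (neg_le_neg ?_)
    have := integral_mono (integrable_const c) hg hcg
    rwa [integral_const, smul_eq_mul, mul_comm] at this
  · exact (Finset.prod_le_prod (fun i _ => measureReal_nonneg)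
      fun i _ => measureReal_mono (subset_univ (A i))).trans (by simp)

theorem integrable_of_bounds {μ : Measure V} [IsFiniteMeasure μ] {g : V → ℝ} (hg : Measurable g)
    {C : ℝ} (hg0 : ∀ v, 0 ≤ g v) (hgC : ∀ v, g v ≤ C) : Integrable g μ :=
  Integrable.of_bound hg.aestronglyMeasurable C <| Filter.Eventually.of_forall fun v => by
    rw [Real.norm_of_nonneg (hg0 v)]
    exact hgC v

theorem integrable_laplaceMoment_integrand {κ : Measure (Measure V)} [IsProbabilityMeasure κ]
    (hκ : ∀ᵐ μ ∂κ, μ univ < ∞) {n : ℕ} {A : Fin n → Set V} (hA : ∀ i, MeasurableSet (A i))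
    {g : V → ℝ} (hg : Measurable g) {c C : ℝ} (hc : 0 < c) (hcg : ∀ v, c ≤ g v)
    (hgC : ∀ v, g v ≤ C) :
    Integrable (fun μ => Real.exp (-∫ v, g v ∂μ) * ∏ i, μ.real (A i)) κ := by
  have hg0 : ∀ v, 0 ≤ g v := fun v => hc.le.trans (hcg v)
  refine Integrable.of_bound (measurable_laplaceMoment_integrand hA hg hg0).aestronglyMeasurable
    (n.factorial / c ^ n) ?_
  filter_upwards [hκ] with μ hμ
  have : IsFiniteMeasure μ := ⟨hμ⟩
  rw [Real.norm_of_nonneg (mul_nonneg (Real.exp_pos _).le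
    (Finset.prod_nonneg fun i _ => measureReal_nonneg))]
  exact laplaceMoment_integrand_le A (integrable_of_bounds hg hg0 hgC) hc hcg

/-- Differentiating the tilt along `B` appends the factor `μ B` to the moment. -/
theorem hasDerivAt_laplaceMoment {κ : Measure (Measure V)} [IsProbabilityMeasure κ]
    (hκ : ∀ᵐ μ ∂κ, μ univ < ∞) {n : ℕ} {A : Fin (n + 1) → Set V}
    (hA : ∀ i, MeasurableSet (A i)) {g : V → ℝ} (hg : Measurable g) {c C : ℝ} (hc : 0 < c)
    (hcg : ∀ v, c ≤ g v) (hgC : ∀ v, g v ≤ C) :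
    HasDerivAt (fun t => laplaceMoment κ (fun i => A i.castSucc)
        fun v => g v + t * (A (Fin.last n)).indicator 1 v)
      (-laplaceMoment κ A g) 0 := by
  set B := A (Fin.last n) with hB
  have hmI : Measurable (B.indicator (1 : V → ℝ)) := measurable_one.indicator (hA _)
  -- halving the lower bound of the tilt leaves an exponential factor that dominates the moments
  have hbd : ∀ t ∈ Metric.ball (0 : ℝ) (c / 2), ∀ v,
      c / 2 ≤ g v + t * B.indicator 1 v ∧ g v + t * B.indicator 1 v ≤ C + c / 2 := by
    intro t ht v
    rw [Metric.mem_ball, Real.dist_eq, sub_zero, abs_lt] at ht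
    have h0 := indicator_one_nonneg B v
    have h1 := indicator_one_le_one B v
    constructor <;> nlinarith [hcg v, hgC v, ht.1, ht.2]
  have hmg : ∀ t : ℝ, Measurable fun v => g v + t * B.indicator 1 v :=
    fun t => hg.add (measurable_const.mul hmI)
  have h0mem : (0 : ℝ) ∈ Metric.ball (0 : ℝ) (c / 2) := Metric.mem_ball_self (by positivity)
  have key := (hasDerivAt_integral_of_dominated_loc_of_deriv_le (μ := κ) (x₀ := (0 : ℝ))
    (F := fun t μ => Real.exp (-∫ v, (g v + t * B.indicator 1 v) ∂μ) *
      ∏ i : Fin n, μ.real (A i.castSucc))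
    (F' := fun t μ => -(Real.exp (-∫ v, (g v + t * B.indicator 1 v) ∂μ) *
      ∏ i : Fin (n + 1), μ.real (A i)))
    (bound := fun _ => (n + 1).factorial / (c / 2) ^ (n + 1))
    (Metric.ball_mem_nhds 0 (half_pos hc)) ?_ ?_ ?_ ?_ (integrable_const _) ?_).2
  · simp only [zero_mul, add_zero, integral_neg] at key
    exact key
  · filter_upwards [Metric.ball_mem_nhds (0 : ℝ) (half_pos hc)] with t ht
    exact (measurable_laplaceMoment_integrand (fun i => hA _) (hmg t)
      fun v => (half_pos hc).le.trans (hbd t ht v).1).aestronglyMeasurable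
  · exact integrable_laplaceMoment_integrand hκ (fun i => hA _) (hmg 0) (half_pos hc)
      (fun v => (hbd 0 h0mem v).1) fun v => (hbd 0 h0mem v).2
  · exact (measurable_laplaceMoment_integrand hA (hmg 0)
      fun v => (half_pos hc).le.trans (hbd 0 h0mem v).1).neg.aestronglyMeasurable
  · filter_upwards [hκ] with μ hμ t ht
    have : IsFiniteMeasure μ := ⟨hμ⟩
    rw [norm_neg, Real.norm_of_nonneg (mul_nonneg (Real.exp_pos _).le
      (Finset.prod_nonneg fun i _ => measureReal_nonneg))]
    exact laplaceMoment_integrand_le A (integrable_of_bounds (hmg t)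
      (fun v => (half_pos hc).le.trans (hbd t ht v).1) fun v => (hbd t ht v).2)
      (half_pos hc) fun v => (hbd t ht v).1
  · filter_upwards [hκ] with μ hμ t ht
    have : IsFiniteMeasure μ := ⟨hμ⟩
    have hig : Integrable g μ := integrable_of_bounds hg (fun v => hc.le.trans (hcg v)) hgC
    have hiI : Integrable (B.indicator (1 : V → ℝ)) μ :=
      integrable_of_bounds hmI (indicator_one_nonneg B) (indicator_one_le_one B)
    have hlin : ∀ s : ℝ, ∫ v, (g v + s * B.indicator 1 v) ∂μ = ∫ v, g v ∂μ + s * μ.real B := by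
      intro s
      rw [integral_add hig (hiI.const_mul s), integral_const_mul, integral_indicator_one (hA _)]
    simp only [hlin]
    have hd : HasDerivAt (fun s : ℝ => ∫ v, g v ∂μ + s * μ.real B) (μ.real B) t := by
      simpa using ((hasDerivAt_id t).mul_const (μ.real B)).const_add (∫ v, g v ∂μ)
    refine (hd.neg.exp.mul_const _).congr_deriv ?_
    rw [Fin.prod_univ_castSucc, Pi.neg_apply]
    ring

variable [MeasurableEq V]

/-- Both sides satisfy the same differential recursion in the tilt, so the formula for the moments
of every order follows from the Laplace functional. -/
theorem laplaceMoment_eq {κ : Measure (Measure V)} [IsProbabilityMeasure κ]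
    (hκ : ∀ᵐ μ ∂κ, μ univ < ∞) {a σ : ℝ} (ha : 0 ≤ a) (hσ0 : 0 < σ) (hσ1 : σ < 1)
    (ν : Measure V) [IsProbabilityMeasure ν] [NullSingletonClass ν]
    (hlap : ∀ (g : V → ℝ) (C : ℝ), Measurable g → (∀ v, 0 ≤ g v) → (∀ v, g v ≤ C) →
      ∫ μ, Real.exp (-∫ v, g v ∂μ) ∂κ = Real.exp (-laplaceExponent a σ ν g))
    (n : ℕ) (A : Fin n → Set V) (hA : ∀ i, MeasurableSet (A i)) (g : V → ℝ) (hg : Measurable g)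
    (c C : ℝ) (hc : 0 < c) (hcg : ∀ v, c ≤ g v) (hgC : ∀ v, g v ≤ C) :
    laplaceMoment κ A g = Real.exp (-laplaceExponent a σ ν g) * boxIntegral a σ ν A g := by
  induction n generalizing g c C with
  | zero =>
    have h1 : boxIntegral a σ ν A g = 1 := by
      simp [boxIntegral, boxIndicator, urnWeight, urnMeasure]
    simpa [laplaceMoment, h1] using hlap g C hg (fun v => hc.le.trans (hcg v)) hgC
  | succ n ih =>
    have hL := hasDerivAt_laplaceMoment hκ hA hg hc hcg hgC
    have hR := hasDerivAt_exp_mul_boxIntegral ha hσ0 hσ1 ν hA hg hc hcg hgC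
    refine neg_injective (hL.unique (hR.congr_of_eventuallyEq ?_))
    filter_upwards [Metric.ball_mem_nhds (0 : ℝ) (half_pos hc)] with t ht
    rw [Metric.mem_ball, Real.dist_eq, sub_zero, abs_lt] at ht
    refine ih _ (fun i => hA _) _
      (hg.add (measurable_const.mul (measurable_one.indicator (hA _)))) (c / 2) (C + c / 2)
      (half_pos hc) (fun v => ?_) fun v => ?_ <;>
    · have h0 := indicator_one_nonneg (A (Fin.last n)) v
      have h1 := indicator_one_le_one (A (Fin.last n)) v
      nlinarith [hcg v, hgC v, ht.1, ht.2]

end Moments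

/-! ### The Laplace functional of the generalized gamma completely random measure -/

section Laplace

theorem lintegral_rpow_mul_exp_neg_mul_Ioi {s r : ℝ} (hs : 0 < s) (hr : 0 < r) :
    ∫⁻ t in Ioi (0 : ℝ), ENNReal.ofReal (t ^ (s - 1) * Real.exp (-(r * t))) =
      ENNReal.ofReal ((1 / r) ^ s * Real.Gamma s) := by
  have h := Real.integral_rpow_mul_exp_neg_mul_Ioi hs hr
  have hpos : 0 < (1 / r) ^ s * Real.Gamma s :=
    mul_pos (Real.rpow_pos_of_pos (by positivity) _) (Real.Gamma_pos_of_pos hs)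
  rw [← h, ofReal_integral_eq_lintegral_ofReal]
  · by_contra hni
    rw [integral_undef hni] at h
    linarith
  · refine (ae_restrict_iff' measurableSet_Ioi).2 (Filter.Eventually.of_forall fun t ht => ?_)
    exact mul_nonneg (Real.rpow_nonneg (le_of_lt ht) _) (Real.exp_pos _).le

theorem lintegral_Ioc_mul_exp_neg_mul {ξ s : ℝ} (hξ : 0 < ξ) (hs : 0 ≤ s) :
    ∫⁻ r in Ioc 0 s, ENNReal.ofReal (ξ * Real.exp (-(ξ * r))) =
      ENNReal.ofReal (1 - Real.exp (-(ξ * s))) := by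
  have hcont : Continuous fun r => ξ * Real.exp (-(ξ * r)) := by fun_prop
  have hint : ∫ r in (0 : ℝ)..s, ξ * Real.exp (-(ξ * r)) = 1 - Real.exp (-(ξ * s)) := by
    rw [intervalIntegral.integral_eq_sub_of_hasDerivAt (f := fun r => -Real.exp (-(ξ * r)))
      (fun r _ => ?_) (hcont.intervalIntegrable _ _)]
    · simp; ring
    · refine (((hasDerivAt_id r).const_mul ξ).neg.exp.neg).congr_deriv ?_
      simp; ring
  rw [← hint, intervalIntegral.integral_of_le hs, ofReal_integral_eq_lintegral_ofReal]
  · exact (hcont.intervalIntegrable 0 s).1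
  · exact Filter.Eventually.of_forall fun r => mul_nonneg hξ.le (Real.exp_pos _).le

theorem lintegral_Ioc_half_add_rpow {a σ s : ℝ} (ha : 0 ≤ a) (hσ0 : 0 < σ) (hs : 0 ≤ s) :
    ∫⁻ r in Ioc 0 s, ENNReal.ofReal (a * (1 / 2 + r) ^ (σ - 1)) =
      ENNReal.ofReal (a / σ * ((1 / 2 + s) ^ σ - (1 / 2 : ℝ) ^ σ)) := by
  have hpos : ∀ r ∈ uIcc 0 s, 0 < 1 / 2 + r := by
    intro r hr
    rw [uIcc_of_le hs] at hr
    linarith [hr.1]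
  have hcont : ContinuousOn (fun r => a * (1 / 2 + r) ^ (σ - 1)) (uIcc 0 s) :=
    continuousOn_const.mul (ContinuousOn.rpow_const (by fun_prop) fun r hr =>
      Or.inl (hpos r hr).ne')
  have hint : ∫ r in (0 : ℝ)..s, a * (1 / 2 + r) ^ (σ - 1) =
      a / σ * ((1 / 2 + s) ^ σ - (1 / 2 : ℝ) ^ σ) := by
    rw [intervalIntegral.integral_eq_sub_of_hasDerivAt (f := fun r => a / σ * (1 / 2 + r) ^ σ)
      (fun r hr => ?_) hcont.intervalIntegrable]
    · simp; ring
    · refine ((((hasDerivAt_id r).const_add (1 / 2)).rpow_const (p := σ)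
        (Or.inl (hpos r hr).ne')).const_mul (a / σ)).congr_deriv ?_
      simp only [id]
      field_simp
  rw [← hint, intervalIntegral.integral_of_le hs, ofReal_integral_eq_lintegral_ofReal]
  · exact hcont.intervalIntegrable.1
  · refine (ae_restrict_iff' measurableSet_Ioc).2 (Filter.Eventually.of_forall fun r hr => ?_)
    exact mul_nonneg ha (Real.rpow_nonneg (by linarith [hr.1]) _)

instance (α σ : ℝ) : SFinite (genGammaJumps α σ) := by
  unfold genGammaJumps
  infer_instance

/-- The Lévy exponent of the generalized gamma subordinator. It follows by Tonelli's theorem from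
`1 - exp (-ξ s) = ∫ r in 0..s, ξ exp (-ξ r)` and the Gamma integral in `ξ`. -/
theorem lintegral_genGammaJumps {α σ s : ℝ} (hα : 0 < α) (hσ0 : 0 < σ) (hσ1 : σ < 1)
    (hs : 0 ≤ s) :
    ∫⁻ ξ, ENNReal.ofReal (1 - Real.exp (-(ξ * s))) ∂(genGammaJumps α σ) =
      ENNReal.ofReal (α * (2 : ℝ) ^ (σ - 1) / σ * ((1 / 2 + s) ^ σ - (1 / 2 : ℝ) ^ σ)) := by
  have hΓ : 0 < Real.Gamma (1 - σ) := Real.Gamma_pos_of_pos (by linarith)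
  have ha : 0 < α * (2 : ℝ) ^ (σ - 1) := by positivity
  set a := α * (2 : ℝ) ^ (σ - 1) with hadef
  rw [genGammaJumps, lintegral_withDensity_eq_lintegral_mul _ (by fun_prop) (by fun_prop),
    ← lintegral_Ioc_half_add_rpow ha.le hσ0 hs]
  calc _ = ∫⁻ ξ in Ioi (0 : ℝ), ∫⁻ r in Ioc 0 s,
        ENNReal.ofReal (a / Real.Gamma (1 - σ)) *
          ENNReal.ofReal (ξ ^ (1 - σ - 1) * Real.exp (-((1 / 2 + r) * ξ))) := by
        refine setLIntegral_congr_fun measurableSet_Ioi fun ξ (hξ : 0 < ξ) => ?_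
        simp only [Pi.mul_apply]
        rw [← lintegral_Ioc_mul_exp_neg_mul hξ hs, ← lintegral_const_mul _ (by fun_prop)]
        refine lintegral_congr fun r => ?_
        rw [← ENNReal.ofReal_mul (by positivity), ← ENNReal.ofReal_mul (by positivity)]
        congr 1
        have h1 : ξ ^ (1 - σ - 1) = ξ ^ (-1 - σ) * ξ := by
          rw [← Real.rpow_add_one hξ.ne']
          congr 1
          ring
        have h2 : Real.exp (-((1 / 2 + r) * ξ)) = Real.exp (-ξ / 2) * Real.exp (-(ξ * r)) := by
          rw [← Real.exp_add]
          congr 1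
          ring
        rw [h1, h2]
        ring
    _ = ∫⁻ r in Ioc 0 s, ∫⁻ ξ in Ioi (0 : ℝ), ENNReal.ofReal (a / Real.Gamma (1 - σ)) *
          ENNReal.ofReal (ξ ^ (1 - σ - 1) * Real.exp (-((1 / 2 + r) * ξ))) :=
        lintegral_lintegral_swap (by fun_prop)
    _ = _ := by
        refine setLIntegral_congr_fun measurableSet_Ioc fun r hr => ?_
        have hr' : 0 < 1 / 2 + r := by linarith [hr.1]
        rw [lintegral_const_mul _ (by fun_prop),
          lintegral_rpow_mul_exp_neg_mul_Ioi (by linarith) hr',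
          ← ENNReal.ofReal_mul (by positivity)]
        congr 1
        rw [one_div (1 / 2 + r), Real.inv_rpow hr'.le, ← Real.rpow_neg hr'.le, neg_sub]
        field_simp

variable {V : Type*} [MeasurableSpace V]

theorem integral_exp_neg_of_isGenGammaCRM {α σ : ℝ} (hα : 0 < α) (hσ0 : 0 < σ) (hσ1 : σ < 1)
    {ν : Measure V} [IsProbabilityMeasure ν] {κ : Measure (Measure V)}
    (hκ : IsGenGammaCRM α σ ν (fun μ : Measure V => μ) κ) (g : V → ℝ) (C : ℝ) (hg : Measurable g)
    (hg0 : ∀ v, 0 ≤ g v) (hgC : ∀ v, g v ≤ C) :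
    ∫ μ, Real.exp (-∫ v, g v ∂μ) ∂κ =
      Real.exp (-laplaceExponent (α * (2 : ℝ) ^ (σ - 1)) σ ν g) := by
  rw [hκ.levy g hg hg0 ?_]
  · congr 2
    have hpos : ∀ᵐ ξ ∂(genGammaJumps α σ), 0 < ξ :=
      (withDensity_absolutelyContinuous _ _).ae_le (ae_restrict_mem measurableSet_Ioi)
    have hpos' : ∀ᵐ z ∂((genGammaJumps α σ).prod ν), 0 < z.1 :=
      Measure.quasiMeasurePreserving_fst.ae hpos
    have hψ : ∀ v, 0 ≤ α * (2 : ℝ) ^ (σ - 1) / σ * ((1 / 2 + g v) ^ σ - (1 / 2 : ℝ) ^ σ) := by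
      intro v
      have := Real.rpow_le_rpow (by norm_num) (by linarith [hg0 v] : (1 / 2 : ℝ) ≤ 1 / 2 + g v)
        hσ0.le
      exact mul_nonneg (by positivity) (by linarith)
    rw [laplaceExponent, integral_eq_lintegral_of_nonneg_ae, integral_eq_lintegral_of_nonneg_ae,
      lintegral_prod_symm' _ (by fun_prop)]
    · congr 1
      exact lintegral_congr fun v => lintegral_genGammaJumps hα hσ0 hσ1 (hg0 v)
    · exact Filter.Eventually.of_forall hψ
    · exact (by fun_prop : Measurable _).aestronglyMeasurable
    · filter_upwards [hpos'] with z hz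
      have : 0 ≤ z.1 * g z.2 := mul_nonneg hz.le (hg0 _)
      simpa using this
    · exact (by fun_prop : Measurable _).aestronglyMeasurable
  · filter_upwards [hκ.mass_pos_finite] with μ hμ
    have : IsFiniteMeasure μ := ⟨hμ.2⟩
    exact integrable_of_bounds hg hg0 hgC

end Laplace

/-! ### The law of a sample -/

section Law

/-- The density `V_{n,k} / a ^ k` of the law of a sample of size `n` with `k` distinct symbols with
respect to the urn measure. It is an extended nonnegative number, so that its finiteness, where it
is needed, can be read off from the total mass of the law. -/
noncomputable def mixWeight (a σ : ℝ) (n k : ℕ) : ℝ≥0∞ :=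
  ∫⁻ u in Ioi (0 : ℝ), ENNReal.ofReal (u ^ ((n : ℝ) - 1) / Real.Gamma n *
    Real.exp (-(a / σ * ((1 / 2 + u) ^ σ - (1 / 2 : ℝ) ^ σ))) *
      (1 / 2 + u) ^ (-((n : ℝ) - k * σ)))

theorem Gamma_natCast_pos {n : ℕ} (hn : 1 ≤ n) : 0 < Real.Gamma n :=
  Real.Gamma_pos_of_pos (by exact_mod_cast hn)

theorem mixWeight_pos (a σ : ℝ) {n : ℕ} (hn : 1 ≤ n) (k : ℕ) : 0 < mixWeight a σ n k := by
  rw [mixWeight, setLIntegral_pos_iff (by fun_prop)]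
  have h : Ioi (0 : ℝ) ⊆ (Function.support fun u : ℝ =>
      ENNReal.ofReal (u ^ ((n : ℝ) - 1) / Real.Gamma n *
        Real.exp (-(a / σ * ((1 / 2 + u) ^ σ - (1 / 2 : ℝ) ^ σ))) *
          (1 / 2 + u) ^ (-((n : ℝ) - k * σ)))) ∩ Ioi 0 := by
    intro u hu
    have hu' : 0 < u := hu
    refine ⟨?_, hu⟩
    have := Gamma_natCast_pos hn
    rw [Function.mem_support]
    exact (ENNReal.ofReal_pos.2 (by positivity)).ne'
  refine lt_of_lt_of_le ?_ (measure_mono h)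
  simp

theorem nggpWeight_eq (α σ : ℝ) {n : ℕ} (hn : 1 ≤ n) (k : ℕ) :
    nggpWeight α σ n k = (α * (2 : ℝ) ^ (σ - 1)) ^ k *
      (mixWeight (α * (2 : ℝ) ^ (σ - 1)) σ n k).toReal := by
  have hΓ := Gamma_natCast_pos hn
  rw [nggpWeight, mixWeight, ← integral_eq_lintegral_of_nonneg_ae, div_mul_eq_mul_div,
    mul_div_assoc, ← integral_div]
  · congr 1
    refine setIntegral_congr_fun measurableSet_Ioi fun u (hu : 0 < u) => ?_
    have h2 : (2 : ℝ) ^ (-σ) = (1 / 2 : ℝ) ^ σ := by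
      rw [one_div, Real.inv_rpow two_pos.le, Real.rpow_neg two_pos.le]
    rw [h2, Real.rpow_neg (by positivity)]
    field_simp
  · refine (ae_restrict_iff' measurableSet_Ioi).2 (Filter.Eventually.of_forall fun u hu => ?_)
    have hu' : 0 < u := hu
    simp only [Pi.zero_apply]
    positivity
  · exact (by fun_prop : Measurable _).aestronglyMeasurable

theorem nggpWeight_nonneg {α : ℝ} (hα : 0 ≤ α) (σ : ℝ) {n : ℕ} (hn : 1 ≤ n) (k : ℕ) :
    0 ≤ nggpWeight α σ n k := by
  rw [nggpWeight_eq α σ hn]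
  positivity

variable {V : Type*} [MeasurableSpace V]

theorem ofReal_boxIndicator {V : Type*} {n : ℕ} (A : Fin n → Set V) (x : Fin n → V) :
    ENNReal.ofReal (boxIndicator A x) = (univ.pi A).indicator 1 x := by
  by_cases hx : x ∈ univ.pi A
  · rw [Set.indicator_of_mem hx, boxIndicator, Finset.prod_eq_one fun i _ => ?_]
    · simp
    · exact Set.indicator_of_mem (hx i (mem_univ i)) _
  · rw [Set.indicator_of_notMem hx]
    obtain ⟨i, hi⟩ : ∃ i, x i ∉ A i := by simpa using hx
    rw [boxIndicator, Finset.prod_eq_zero (Finset.mem_univ i) (Set.indicator_of_notMem hi _)]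
    simp

theorem prod_normalizeMeasure_apply {μ : Measure V} (h0 : 0 < μ univ) (h1 : μ univ < ∞) {n : ℕ}
    (hn : 1 ≤ n) (A : Fin n → Set V) :
    ∏ i, normalizeMeasure μ (A i) =
      ∫⁻ u in Ioi (0 : ℝ), ENNReal.ofReal (u ^ ((n : ℝ) - 1) / Real.Gamma n) *
        ENNReal.ofReal (Real.exp (-(μ.real univ * u)) * ∏ i, μ.real (A i)) := by
  have : IsFiniteMeasure μ := ⟨h1⟩
  have hT : 0 < μ.real univ := ENNReal.toReal_pos h0.ne' h1.ne
  have hΓ := Gamma_natCast_pos hn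
  have hA0 : 0 ≤ ∏ i, μ.real (A i) := Finset.prod_nonneg fun i _ => measureReal_nonneg
  calc ∏ i, normalizeMeasure μ (A i)
      = ∏ i, ENNReal.ofReal ((μ.real univ)⁻¹ * μ.real (A i)) := by
        refine Finset.prod_congr rfl fun i _ => ?_
        rw [normalizeMeasure, Measure.smul_apply, smul_eq_mul,
          ENNReal.ofReal_mul (inv_nonneg.2 hT.le), ENNReal.ofReal_inv_of_pos hT,
          ofReal_measureReal, ofReal_measureReal]
    _ = ENNReal.ofReal ((∏ i, μ.real (A i)) / Real.Gamma n) *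
          ENNReal.ofReal ((1 / μ.real univ) ^ (n : ℝ) * Real.Gamma n) := by
        rw [← ENNReal.ofReal_prod_of_nonneg fun i _ => by positivity,
          ← ENNReal.ofReal_mul (by positivity)]
        congr 1
        rw [Finset.prod_mul_distrib, Finset.prod_const, Finset.card_univ, Fintype.card_fin,
          Real.rpow_natCast, one_div]
        field_simp
    _ = _ := by
        rw [← lintegral_rpow_mul_exp_neg_mul_Ioi (by exact_mod_cast hn) hT,
          ← lintegral_const_mul _ (by fun_prop)]
        refine setLIntegral_congr_fun measurableSet_Ioi fun u (hu : 0 < u) => ?_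
        rw [← ENNReal.ofReal_mul (by positivity), ← ENNReal.ofReal_mul (by positivity)]
        congr 1
        ring

variable [MeasurableEq V]

/-- The law of a sample of size `n` from the normalized measure, on boxes. Tonelli's theorem is
applied to `T ^ (-n) = Γ(n)⁻¹ ∫ u ^ (n - 1) exp (-u T) du`, where `T` is the total mass. -/
theorem lintegral_prod_normalizeMeasure {α σ : ℝ} (hα : 0 < α) (hσ0 : 0 < σ) (hσ1 : σ < 1)
    {ν : Measure V} [IsProbabilityMeasure ν] [NullSingletonClass ν] {κ : Measure (Measure V)}
    [IsProbabilityMeasure κ] (hκ : IsGenGammaCRM α σ ν (fun μ : Measure V => μ) κ) {n : ℕ}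
    (hn : 1 ≤ n) {A : Fin n → Set V} (hA : ∀ i, MeasurableSet (A i)) :
    ∫⁻ μ, ∏ i, normalizeMeasure μ (A i) ∂κ =
      ∫⁻ x in univ.pi A, mixWeight (α * (2 : ℝ) ^ (σ - 1)) σ n (numDistinct x)
        ∂(urnMeasure (α * (2 : ℝ) ^ (σ - 1)) σ ν n) := by
  set a := α * (2 : ℝ) ^ (σ - 1) with hadef
  have ha : 0 < a := by positivity
  have hΓ := Gamma_natCast_pos hn
  have hfin : ∀ᵐ μ ∂κ, μ univ < ∞ := hκ.mass_pos_finite.mono fun μ h => h.2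
  have hmreal : ∀ {s : Set V}, MeasurableSet s → Measurable fun μ : Measure V => μ.real s :=
    fun hs => (Measure.measurable_coe hs).ennreal_toReal
  have hmNum : Measurable fun x : Fin n → V => (numDistinct x : ℝ) :=
    measurable_comp_numDistinct fun k => (k : ℝ)
  calc ∫⁻ μ, ∏ i, normalizeMeasure μ (A i) ∂κ
      = ∫⁻ μ, (∫⁻ u in Ioi (0 : ℝ), ENNReal.ofReal (u ^ ((n : ℝ) - 1) / Real.Gamma n) *
          ENNReal.ofReal (Real.exp (-(μ.real univ * u)) * ∏ i, μ.real (A i))) ∂κ := by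
        refine lintegral_congr_ae ?_
        filter_upwards [hκ.mass_pos_finite] with μ hμ
        exact prod_normalizeMeasure_apply hμ.1 hμ.2 hn A
    _ = ∫⁻ u in Ioi (0 : ℝ), ∫⁻ μ, ENNReal.ofReal (u ^ ((n : ℝ) - 1) / Real.Gamma n) *
          ENNReal.ofReal (Real.exp (-(μ.real univ * u)) * ∏ i, μ.real (A i)) ∂κ := by
        refine lintegral_lintegral_swap (Measurable.aemeasurable ?_)
        refine Measurable.mul (by fun_prop) (Measurable.ennreal_ofReal (Measurable.mul ?_ ?_))
        · exact (((hmreal MeasurableSet.univ).comp measurable_fst).mul measurable_snd).neg.exp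
        · exact Finset.measurable_prod _ fun i _ => (hmreal (hA i)).comp measurable_fst
    _ = ∫⁻ u in Ioi (0 : ℝ), ∫⁻ x, (univ.pi A).indicator 1 x *
          ENNReal.ofReal (u ^ ((n : ℝ) - 1) / Real.Gamma n *
            Real.exp (-(a / σ * ((1 / 2 + u) ^ σ - (1 / 2 : ℝ) ^ σ))) *
              (1 / 2 + u) ^ (-((n : ℝ) - numDistinct x * σ))) ∂(urnMeasure a σ ν n) := by
        refine setLIntegral_congr_fun measurableSet_Ioi fun u (hu : 0 < u) => ?_
        have hm1 : Measurable fun μ : Measure V =>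
            Real.exp (-(μ.real univ * u)) * ∏ i, μ.real (A i) :=
          ((hmreal MeasurableSet.univ).mul measurable_const).neg.exp.mul
            (Finset.measurable_prod _ fun i _ => hmreal (hA i))
        have hm2 : Measurable fun x : Fin n → V =>
            boxIndicator A x * urnWeight σ (fun _ => u) x :=
          (measurable_boxIndicator hA).mul (measurable_urnWeight σ measurable_const)
        rw [lintegral_const_mul _ hm1.ennreal_ofReal]
        have hmom := laplaceMoment_eq hfin ha.le hσ0 hσ1 ν
          (integral_exp_neg_of_isGenGammaCRM hα hσ0 hσ1 hκ) n A hA (fun _ => u) measurable_const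
          u u hu (fun _ => le_rfl) fun _ => le_rfl
        have hint := integrable_laplaceMoment_integrand hfin hA (g := fun _ => u) measurable_const
          hu (fun _ => le_rfl) fun _ => le_rfl
        have hbox := (hasDerivAt_boxIntegral (a := a) hσ0 hσ1 ν hA (g := fun _ => u)
          measurable_const hu (fun _ => le_rfl) MeasurableSet.empty).2.2
        have hψ : laplaceExponent a σ ν (fun _ => u) =
            a / σ * ((1 / 2 + u) ^ σ - (1 / 2 : ℝ) ^ σ) := by
          simp [laplaceExponent]
        simp only [laplaceMoment, integral_const, smul_eq_mul] at hmom hint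
        rw [← ofReal_integral_eq_lintegral_ofReal hint (Filter.Eventually.of_forall fun μ =>
          mul_nonneg (Real.exp_pos _).le (Finset.prod_nonneg fun i _ => measureReal_nonneg)),
          hmom, hψ, boxIntegral, ENNReal.ofReal_mul (Real.exp_pos _).le,
          ofReal_integral_eq_lintegral_ofReal hbox (Filter.Eventually.of_forall fun x =>
            mul_nonneg (boxIndicator_nonneg A x) (urnWeight_pos _ _ x).le), ← mul_assoc,
          ← lintegral_const_mul _ hm2.ennreal_ofReal]
        refine lintegral_congr fun x => ?_
        rw [ENNReal.ofReal_mul (boxIndicator_nonneg A x), ofReal_boxIndicator,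
          urnWeight_const σ hu.le, ENNReal.ofReal_mul (by positivity),
          ENNReal.ofReal_mul (by positivity)]
        ring
    _ = ∫⁻ x, (∫⁻ u in Ioi (0 : ℝ), (univ.pi A).indicator 1 x *
          ENNReal.ofReal (u ^ ((n : ℝ) - 1) / Real.Gamma n *
            Real.exp (-(a / σ * ((1 / 2 + u) ^ σ - (1 / 2 : ℝ) ^ σ))) *
              (1 / 2 + u) ^ (-((n : ℝ) - numDistinct x * σ)))) ∂(urnMeasure a σ ν n) := by
        refine lintegral_lintegral_swap (Measurable.aemeasurable ?_)
        refine Measurable.mul ((measurable_one.indicator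
          (MeasurableSet.univ_pi hA)).comp measurable_snd) (Measurable.ennreal_ofReal ?_)
        have : Measurable fun p : ℝ × (Fin n → V) => (numDistinct p.2 : ℝ) :=
          hmNum.comp measurable_snd
        refine Measurable.mul (by fun_prop) (Measurable.pow (by fun_prop) ?_)
        exact (measurable_const.sub (this.mul measurable_const)).neg
    _ = _ := by
        rw [← lintegral_indicator (MeasurableSet.univ_pi hA)]
        refine lintegral_congr fun x => ?_
        rw [lintegral_const_mul _ (by fun_prop)]
        by_cases hx : x ∈ univ.pi A <;> simp [hx, mixWeight]

variable {Ω : Type*} [MeasurableSpace Ω]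

theorem measurable_normalizeMeasure {V : Type*} [MeasurableSpace V] :
    Measurable (normalizeMeasure : Measure V → Measure V) := by
  refine Measure.measurable_of_measurable_coe _ fun s hs => ?_
  simp only [normalizeMeasure, Measure.smul_apply, smul_eq_mul]
  exact (Measure.measurable_coe MeasurableSet.univ).inv.mul (Measure.measurable_coe hs)

/-- The law of a sample has density `mixWeight` with respect to the urn measure. -/
theorem map_sample_eq_withDensity {Pr : Measure Ω} [IsProbabilityMeasure Pr] {α σ : ℝ}
    (hα : 0 < α) (hσ0 : 0 < σ) (hσ1 : σ < 1) {ν : Measure V} [IsProbabilityMeasure ν]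
    [NullSingletonClass ν] {P : Ω → Measure V} (hP : IsNGGP α σ ν P Pr) {n : ℕ} (hn : 1 ≤ n)
    {X : Fin n → Ω → V} (hX : IsSampleFrom X P Pr) :
    Pr.map (fun ω i => X i ω) = (urnMeasure (α * (2 : ℝ) ^ (σ - 1)) σ ν n).withDensity
      fun x => mixWeight (α * (2 : ℝ) ^ (σ - 1)) σ n (numDistinct x) := by
  obtain ⟨κ, hκp, hκ, hlaw⟩ := hP.law
  have hXm : Measurable fun ω i => X i ω := measurable_pi_lambda _ hX.measurable
  have hbox : ∀ A : Fin n → Set V, (∀ i, MeasurableSet (A i)) →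
      Pr.map (fun ω i => X i ω) (univ.pi A) =
        (urnMeasure (α * (2 : ℝ) ^ (σ - 1)) σ ν n).withDensity
          (fun x => mixWeight (α * (2 : ℝ) ^ (σ - 1)) σ n (numDistinct x)) (univ.pi A) := by
    intro A hA
    have hprod : Measurable fun ρ : Measure V => ∏ i, ρ (A i) :=
      Finset.measurable_prod _ fun i _ => Measure.measurable_coe (hA i)
    rw [withDensity_apply _ (MeasurableSet.univ_pi hA),
      ← lintegral_prod_normalizeMeasure hα hσ0 hσ1 hκ hn hA,
      Measure.map_apply hXm (MeasurableSet.univ_pi hA),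
      ← lintegral_map (f := fun ρ : Measure V => ∏ i, ρ (A i)) hprod measurable_normalizeMeasure,
      ← hlaw, lintegral_map hprod hP.measurable]
    have h := hX.cond_iid univ A MeasurableSet.univ hA
    simp only [mem_univ, ofPred_true, Measure.restrict_univ, univ_inter] at h
    rw [← h]
    congr 1
    ext ω
    simp
  have : IsProbabilityMeasure (Pr.map fun ω i => X i ω) :=
    Measure.isProbabilityMeasure_map hXm.aemeasurable
  refine ext_of_generate_finite _ generateFrom_pi.symm isPiSystem_pi ?_ ?_
  · rintro _ ⟨A, hA, rfl⟩
    exact hbox A fun i => hA i (mem_univ i)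
  · simpa using hbox (fun _ => univ) fun _ => MeasurableSet.univ

theorem IsNGGP.ae_apply_univ {V : Type*} [MeasurableSpace V] {Pr : Measure Ω} {α σ : ℝ}
    {ν : Measure V} {P : Ω → Measure V} (hP : IsNGGP α σ ν P Pr) : ∀ᵐ ω ∂Pr, P ω univ = 1 := by
  obtain ⟨κ, -, hκ, hlaw⟩ := hP.law
  have hs : MeasurableSet {ρ : Measure V | ρ univ = 1} :=
    Measure.measurable_coe MeasurableSet.univ (measurableSet_singleton 1)
  rw [← ae_map_iff (p := fun ρ : Measure V => ρ univ = 1) hP.measurable.aemeasurable hs, hlaw,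
    ae_map_iff measurable_normalizeMeasure.aemeasurable hs]
  filter_upwards [hκ.mass_pos_finite] with μ hμ
  simp only [normalizeMeasure, Measure.smul_apply, smul_eq_mul]
  exact ENNReal.inv_mul_cancel hμ.1.ne' hμ.2.ne

/-- A sample without its last observation is a sample. -/
theorem IsSampleFrom.castSucc {V : Type*} [MeasurableSpace V] {Pr : Measure Ω}
    {P : Ω → Measure V} (hP : ∀ᵐ ω ∂Pr, P ω univ = 1) {n : ℕ} {X : Fin (n + 1) → Ω → V}
    (hX : IsSampleFrom X P Pr) : IsSampleFrom (fun i : Fin n => X i.castSucc) P Pr := by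
  refine ⟨fun i => hX.measurable _, fun B A hB hA => ?_⟩
  have h := hX.cond_iid B (Fin.snoc A univ) hB fun i => by
    refine Fin.lastCases ?_ (fun j => ?_) i
    · simp
    · simpa using hA j
  simp only [Fin.forall_fin_succ', Fin.snoc_castSucc, Fin.snoc_last, mem_univ, and_true,
    Fin.prod_univ_castSucc] at h
  rw [h]
  refine lintegral_congr_ae (ae_restrict_of_ae ?_)
  filter_upwards [hP] with ω hω
  rw [hω, mul_one]

end Law

/-! ### Recognizing conditional probabilities -/

section Conditioning

variable {Ω E : Type*} [MeasurableSpace Ω] [MeasurableSpace E] {Pr : Measure Ω}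
  [IsProbabilityMeasure Pr]

/-- A version of the conditional probability of `N` given `Y` is recognized by its integrals over
the events `Y ∈ S`. -/
theorem condExp_indicator_ae_eq_comp {Y : Ω → E} (hY : Measurable Y) {N : Set Ω}
    (hN : MeasurableSet N) {p : E → ℝ} (hp : Measurable p) (hp0 : ∀ x, 0 ≤ p x)
    (h : ∀ S, MeasurableSet S →
      Pr (Y ⁻¹' S ∩ N) = ∫⁻ ω in Y ⁻¹' S, ENNReal.ofReal (p (Y ω)) ∂Pr) :
    Pr[N.indicator (fun _ => (1 : ℝ)) | MeasurableSpace.comap Y inferInstance]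
      =ᵐ[Pr] fun ω => p (Y ω) := by
  have hpY : Measurable fun ω => p (Y ω) := hp.comp hY
  have hint : Integrable (fun ω => p (Y ω)) Pr := by
    refine ⟨hpY.aestronglyMeasurable, ?_⟩
    rw [hasFiniteIntegral_iff_ofReal (Filter.Eventually.of_forall fun ω => hp0 _)]
    have := h univ MeasurableSet.univ
    rw [preimage_univ, Measure.restrict_univ] at this
    rw [← this]
    exact measure_lt_top _ _
  refine (ae_eq_condExp_of_forall_setIntegral_eq hY.comap_le
    ((integrable_const (1 : ℝ)).indicator hN) (fun s _ _ => hint.integrableOn) ?_ ?_).symm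
  · rintro s ⟨S, hS, rfl⟩ -
    rw [integral_eq_lintegral_of_nonneg_ae (Filter.Eventually.of_forall fun ω => hp0 _)
      hpY.aestronglyMeasurable, ← h S hS, integral_indicator hN, setIntegral_const, smul_eq_mul,
      mul_one, measureReal_def, Measure.restrict_apply hN, inter_comm]
  · exact (hp.comp (comap_measurable Y)).aestronglyMeasurable

/-- If the conditional probability of `N` given `Y` is constant on the event `Y ∈ S`, then it is
the elementary conditional probability given this event. -/
theorem cond_toReal_eq_of_const {Y : Ω → E} (hY : Measurable Y) {N : Set Ω} {p : E → ℝ} {S : Set E}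
    (hS : MeasurableSet S)
    (h : Pr (Y ⁻¹' S ∩ N) = ∫⁻ ω in Y ⁻¹' S, ENNReal.ofReal (p (Y ω)) ∂Pr)
    (h0 : Pr (Y ⁻¹' S) ≠ 0) {b : ℝ} (hb : 0 ≤ b) (hpb : ∀ x ∈ S, p x = b) :
    (Pr[N | Y ⁻¹' S]).toReal = b := by
  have hc : ∫⁻ ω in Y ⁻¹' S, ENNReal.ofReal (p (Y ω)) ∂Pr = ENNReal.ofReal b * Pr (Y ⁻¹' S) := by
    rw [← setLIntegral_const]
    exact setLIntegral_congr_fun (hY hS) fun ω hω => by rw [hpb _ hω]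
  rw [cond_apply (hY hS), h, hc, mul_comm, mul_assoc,
    ENNReal.mul_inv_cancel h0 (measure_ne_top _ _), mul_one, ENNReal.toReal_ofReal hb]

end Conditioning

/-! ### Predictive probabilities -/

section Predictive

variable {V : Type*} [MeasurableSpace V]

/-- The predictive probability of the symbols of frequency `r` given the data `x`. -/
noncomputable def predictiveProb (α σ : ℝ) {m : ℕ} (r : ℕ) (x : Fin m → V) : ℝ :=
  if r = 0 then
    nggpWeight α σ (m + 1) (numDistinct x + 1) / nggpWeight α σ m (numDistinct x)
  else
    ((r : ℝ) - σ) * freqCount x r *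
      (nggpWeight α σ (m + 1) (numDistinct x) / nggpWeight α σ m (numDistinct x))

theorem predictiveProb_nonneg {V : Type*} {α σ : ℝ} (hα : 0 < α) (hσ1 : σ < 1) {m : ℕ}
    (hm : 1 ≤ m) (r : ℕ) (x : Fin m → V) : 0 ≤ predictiveProb α σ r x := by
  have h1 := fun k => nggpWeight_nonneg hα.le σ hm k
  have h2 := fun k => nggpWeight_nonneg hα.le σ (Nat.le_add_left 1 m) k
  unfold predictiveProb
  split_ifs with hr
  · exact div_nonneg (h2 _) (h1 _)
  · have : (1 : ℝ) ≤ r := by exact_mod_cast Nat.one_le_iff_ne_zero.2 hr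
    exact mul_nonneg (mul_nonneg (by linarith) (by positivity)) (div_nonneg (h2 _) (h1 _))

variable [MeasurableEq V]

theorem measurable_predictiveProb (α σ : ℝ) {m : ℕ} (r : ℕ) :
    Measurable fun x : Fin m → V => predictiveProb α σ r x := by
  unfold predictiveProb
  split_ifs with hr
  · exact measurable_comp_numDistinct fun k =>
      nggpWeight α σ (m + 1) (k + 1) / nggpWeight α σ m k
  · refine Measurable.mul (measurable_const.mul ?_) (measurable_comp_numDistinct fun k =>
      nggpWeight α σ (m + 1) k / nggpWeight α σ m k)
    exact measurable_from_nat.comp (measurable_freqCount (Nat.one_le_iff_ne_zero.2 hr))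

/-- The density, with respect to the urn measure, of the event that the next draw has frequency `r`
in the data. -/
noncomputable def predictiveDensity (a σ : ℝ) {m : ℕ} (r : ℕ) (x : Fin m → V) : ℝ≥0∞ :=
  if r = 0 then ENNReal.ofReal a * mixWeight a σ (m + 1) (numDistinct x + 1)
  else ENNReal.ofReal (((r : ℝ) - σ) * freqCount x r) * mixWeight a σ (m + 1) (numDistinct x)

theorem measurable_predictiveDensity (a σ : ℝ) {m : ℕ} (r : ℕ) :
    Measurable fun x : Fin m → V => predictiveDensity a σ r x := by
  unfold predictiveDensity
  split_ifs with hr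
  · exact measurable_const.mul
      (measurable_comp_numDistinct fun k => mixWeight a σ (m + 1) (k + 1))
  · refine Measurable.mul (measurable_const.mul ?_).ennreal_ofReal
      (measurable_comp_numDistinct (mixWeight a σ (m + 1)))
    exact measurable_from_nat.comp (measurable_freqCount (Nat.one_le_iff_ne_zero.2 hr))

theorem ofReal_predictiveProb_mul {V : Type*} {α σ : ℝ} (hα : 0 < α) (hσ1 : σ < 1) {m : ℕ}
    (hm : 1 ≤ m) (r : ℕ) (x : Fin m → V)
    (h1 : mixWeight (α * (2 : ℝ) ^ (σ - 1)) σ m (numDistinct x) < ∞)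
    (h2 : predictiveDensity (α * (2 : ℝ) ^ (σ - 1)) σ r x < ∞) :
    mixWeight (α * (2 : ℝ) ^ (σ - 1)) σ m (numDistinct x) *
      ENNReal.ofReal (predictiveProb α σ r x) =
        predictiveDensity (α * (2 : ℝ) ^ (σ - 1)) σ r x := by
  have ha : 0 < α * (2 : ℝ) ^ (σ - 1) := by positivity
  have hpos : 0 < (mixWeight (α * (2 : ℝ) ^ (σ - 1)) σ m (numDistinct x)).toReal :=
    ENNReal.toReal_pos (mixWeight_pos _ σ hm _).ne' h1.ne
  rw [← ENNReal.toReal_eq_toReal_iff' (ENNReal.mul_lt_top h1 ENNReal.ofReal_lt_top).ne h2.ne,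
    ENNReal.toReal_mul, ENNReal.toReal_ofReal (predictiveProb_nonneg hα hσ1 hm r x)]
  unfold predictiveProb predictiveDensity
  rw [nggpWeight_eq α σ hm]
  split_ifs with hr
  · rw [nggpWeight_eq α σ (Nat.le_add_left 1 m), ENNReal.toReal_mul, ENNReal.toReal_ofReal ha.le]
    field_simp
    ring
  · have : (1 : ℝ) ≤ r := by exact_mod_cast Nat.one_le_iff_ne_zero.2 hr
    rw [nggpWeight_eq α σ (Nat.le_add_left 1 m), ENNReal.toReal_mul,
      ENNReal.toReal_ofReal (mul_nonneg (by linarith) (by positivity))]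
    field_simp

/-- Given the data, a draw from the unnormalized predictive kernel has frequency `0` only through
its diffuse part and frequency `r ≥ 1` only through its atoms, whose weights add up to
`(r - σ) * freqCount x r`. -/
theorem lintegral_indicator_symbolFreq {V : Type*} [MeasurableSpace V] {a σ : ℝ} (hσ1 : σ < 1)
    (ν : Measure V) [IsProbabilityMeasure ν] [NullSingletonClass ν] {m : ℕ} (r : ℕ)
    (x : Fin m → V) :
    (ENNReal.ofReal a * ∫⁻ y, {z : Fin (m + 1) → V |
        symbolFreq (fun i : Fin m => z i.castSucc) (z (Fin.last m)) = r}.indicator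
          (fun z => mixWeight a σ (m + 1) (numDistinct z)) (Fin.snoc x y) ∂ν +
      ∑ i, ENNReal.ofReal (discount σ x i) * {z : Fin (m + 1) → V |
        symbolFreq (fun i : Fin m => z i.castSucc) (z (Fin.last m)) = r}.indicator
          (fun z => mixWeight a σ (m + 1) (numDistinct z)) (Fin.snoc x (x i))) =
      predictiveDensity a σ r x := by
  classical
  have hnew : ∀ᵐ y ∂ν, y ∉ Set.range x :=
    measure_eq_zero_iff_ae_notMem.1 ((Set.finite_range x).measure_zero ν)
  have hind : ∀ y, {z : Fin (m + 1) → V |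
      symbolFreq (fun i : Fin m => z i.castSucc) (z (Fin.last m)) = r}.indicator
        (fun z => mixWeight a σ (m + 1) (numDistinct z)) (Fin.snoc x y) =
      if symbolFreq x y = r then
        mixWeight a σ (m + 1) (numDistinct (Fin.snoc x y : Fin (m + 1) → V)) else 0 := by
    intro y
    simp [Set.indicator_apply]
  simp only [hind]
  have hA : ∫⁻ y, (if symbolFreq x y = r then
      mixWeight a σ (m + 1) (numDistinct (Fin.snoc x y : Fin (m + 1) → V)) else 0) ∂ν =
      if r = 0 then mixWeight a σ (m + 1) (numDistinct x + 1) else 0 := by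
    rw [lintegral_congr_ae (g := fun _ =>
      if r = 0 then mixWeight a σ (m + 1) (numDistinct x + 1) else 0), lintegral_const,
      measure_univ, mul_one]
    filter_upwards [hnew] with y hy
    rw [(symbolFreq_eq_zero_iff x y).2 hy, numDistinct_snoc_of_notMem x hy]
    simp only [eq_comm]
  have hB : ∀ i, (if symbolFreq x (x i) = r then
      mixWeight a σ (m + 1) (numDistinct (Fin.snoc x (x i) : Fin (m + 1) → V)) else 0) =
      if symbolFreq x (x i) = r then mixWeight a σ (m + 1) (numDistinct x) else 0 := fun i => by
    rw [numDistinct_snoc_of_mem x ⟨i, rfl⟩]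
  simp only [hA, hB]
  unfold predictiveDensity
  by_cases hr : r = 0
  · subst hr
    have hno : ∀ i, symbolFreq x (x i) ≠ 0 := fun i h =>
      (symbolFreq_eq_zero_iff x (x i)).1 h ⟨i, rfl⟩
    simp [hno]
  · simp only [hr, if_false, mul_zero, zero_add]
    rw [← sum_discount_freq σ x (Nat.one_le_iff_ne_zero.2 hr), ENNReal.ofReal_sum_of_nonneg,
      Finset.sum_mul]
    · refine Finset.sum_congr rfl fun i _ => ?_
      split_ifs <;> simp
    · intro i _
      split_ifs
      exacts [(discount_pos hσ1 x i).le, le_rfl]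

/-- The joint law of the data and of the frequency of the next draw. -/
theorem measure_data_inter_next {Ω : Type*} [MeasurableSpace Ω] {Pr : Measure Ω}
    [IsProbabilityMeasure Pr] {α σ : ℝ} (hα : 0 < α) (hσ0 : 0 < σ) (hσ1 : σ < 1)
    {ν : Measure V} [IsProbabilityMeasure ν] [NullSingletonClass ν]
    {P : Ω → Measure V} (hP : IsNGGP α σ ν P Pr) {m : ℕ} (hm : 1 ≤ m)
    {X : Fin (m + 1) → Ω → V} (hX : IsSampleFrom X P Pr) (r : ℕ) {S : Set (Fin m → V)}
    (hS : MeasurableSet S) :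
    Pr ((fun ω (i : Fin m) => X i.castSucc ω) ⁻¹' S ∩
        {ω | symbolFreq (fun i : Fin m => X i.castSucc ω) (X (Fin.last m) ω) = r}) =
      ∫⁻ ω in (fun ω (i : Fin m) => X i.castSucc ω) ⁻¹' S,
        ENNReal.ofReal (predictiveProb α σ r fun i : Fin m => X i.castSucc ω) ∂Pr := by
  set a := α * (2 : ℝ) ^ (σ - 1) with hadef
  have hdata := IsSampleFrom.castSucc hP.ae_apply_univ hX
  have hlaw := map_sample_eq_withDensity hα hσ0 hσ1 hP hm hdata
  have hlaw' := map_sample_eq_withDensity hα hσ0 hσ1 hP (Nat.le_add_left 1 m) hX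
  rw [← hadef] at hlaw hlaw'
  have hYm : Measurable fun ω (i : Fin m) => X i.castSucc ω :=
    measurable_pi_lambda _ hdata.measurable
  have hZm : Measurable fun ω i => X i ω := measurable_pi_lambda _ hX.measurable
  have hinit : Measurable fun (z : Fin (m + 1) → V) (i : Fin m) => z i.castSucc :=
    measurable_pi_lambda _ fun i => measurable_pi_apply _
  have hR : MeasurableSet {z : Fin (m + 1) → V |
      symbolFreq (fun i : Fin m => z i.castSucc) (z (Fin.last m)) = r} :=
    measurableSet_eq_fun
      (measurable_symbolFreq.comp (hinit.prodMk (measurable_pi_apply _))) measurable_const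
  have hmix : Measurable fun z : Fin (m + 1) → V => mixWeight a σ (m + 1) (numDistinct z) :=
    measurable_comp_numDistinct (mixWeight a σ (m + 1))
  have hjoint : ∀ T : Set (Fin m → V), MeasurableSet T →
      Pr ((fun ω (i : Fin m) => X i.castSucc ω) ⁻¹' T ∩
        {ω | symbolFreq (fun i : Fin m => X i.castSucc ω) (X (Fin.last m) ω) = r}) =
      ∫⁻ x in T, predictiveDensity a σ r x ∂(urnMeasure a σ ν m) := by
    intro T hT
    have hTR : MeasurableSet ((fun (z : Fin (m + 1) → V) (i : Fin m) => z i.castSucc) ⁻¹' T ∩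
        {z | symbolFreq (fun i : Fin m => z i.castSucc) (z (Fin.last m)) = r}) :=
      (hinit hT).inter hR
    change Pr ((fun ω i => X i ω) ⁻¹'
      ((fun (z : Fin (m + 1) → V) (i : Fin m) => z i.castSucc) ⁻¹' T ∩
        {z | symbolFreq (fun i : Fin m => z i.castSucc) (z (Fin.last m)) = r})) = _
    rw [← Measure.map_apply hZm hTR, hlaw', withDensity_apply _ hTR, ← lintegral_indicator hTR,
      lintegral_urnMeasure_succ a σ ν m (hmix.indicator hTR), ← lintegral_indicator hT]
    refine lintegral_congr fun x => ?_
    by_cases hx : x ∈ T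
    · rw [Set.indicator_of_mem hx, ← lintegral_indicator_symbolFreq hσ1 ν r x]
      simp only [← Set.indicator_indicator]
      simp [Set.indicator_apply, hx]
    · rw [Set.indicator_of_notMem hx]
      simp [hx]
  -- both densities integrate to at most one, so they are finite almost everywhere
  have hfin1 : ∀ᵐ x ∂(urnMeasure a σ ν m), mixWeight a σ m (numDistinct x) < ∞ := by
    refine ae_lt_top (measurable_comp_numDistinct (mixWeight a σ m)) ?_
    rw [← Measure.restrict_univ (μ := urnMeasure a σ ν m),
      ← withDensity_apply _ MeasurableSet.univ]
    rw [← hlaw, Measure.map_apply hYm MeasurableSet.univ]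
    exact measure_ne_top _ _
  have hfin2 : ∀ᵐ x ∂(urnMeasure a σ ν m), predictiveDensity a σ r x < ∞ := by
    refine ae_lt_top (measurable_predictiveDensity a σ r) ?_
    rw [← Measure.restrict_univ (μ := urnMeasure a σ ν m), ← hjoint univ MeasurableSet.univ]
    exact measure_ne_top _ _
  have hp : Measurable fun x : Fin m → V => ENNReal.ofReal (predictiveProb α σ r x) :=
    (measurable_predictiveProb α σ r).ennreal_ofReal
  rw [hjoint S hS, ← setLIntegral_map hS hp hYm, hlaw,
    setLIntegral_withDensity_eq_setLIntegral_mul _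
      (measurable_comp_numDistinct (mixWeight a σ m)) hp hS]
  refine lintegral_congr_ae (ae_restrict_of_ae ?_)
  filter_upwards [hfin1, hfin2] with x h1 h2
  exact (ofReal_predictiveProb_mul hα hσ1 hm r x h1 h2).symm

end Predictive

theorem proposition1 {Ω V : Type*} [MeasurableSpace Ω] [MeasurableSpace V] [MeasurableEq V]
    (Pr : Measure Ω) [IsProbabilityMeasure Pr]
    (α σ : ℝ) (hα : 0 < α) (hσ0 : 0 < σ) (hσ1 : σ < 1)
    (ν : Measure V) [IsProbabilityMeasure ν] [NullSingletonClass ν]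
    (P : Ω → Measure V) (hP : IsNGGP α σ ν P Pr)
    (m : ℕ) (hm : 1 ≤ m) (X : Fin (m + 1) → Ω → V) (hX : IsSampleFrom X P Pr)
    -- `data` is the sample `X_{1:m}`, `next r` the event that `X_{m+1}` lies in `v_r`
    (data : Ω → Fin m → V) (hdata : data = fun ω i => X i.castSucc ω)
    (next : ℕ → Set Ω) (hnext : next = fun r => {ω | X (Fin.last m) ω ∈ symbolsOfFreq (data ω) r}) :
    -- conditionally on `X_{1:m}`
    (Pr[(next 0).indicator (fun _ => (1 : ℝ)) | MeasurableSpace.comap data inferInstance]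
      =ᵐ[Pr] fun ω =>
        nggpWeight α σ (m + 1) (numDistinct (data ω) + 1) /
          nggpWeight α σ m (numDistinct (data ω))) ∧
    (∀ r : ℕ, 1 ≤ r → r ≤ m →
      Pr[(next r).indicator (fun _ => (1 : ℝ)) | MeasurableSpace.comap data inferInstance]
        =ᵐ[Pr] fun ω =>
          ((r : ℝ) - σ) * freqCount (data ω) r *
            (nggpWeight α σ (m + 1) (numDistinct (data ω)) /
              nggpWeight α σ m (numDistinct (data ω)))) ∧
    -- conditionally on the event `M_m = (c_1, …, c_m)`, with `k = c_1 + ⋯ + c_m`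
    (∀ (c : ℕ → ℕ) (k : ℕ) (F : Set Ω), k = ∑ r ∈ Finset.Icc 1 m, c r →
      F = {ω | ∀ r ∈ Finset.Icc 1 m, freqCount (data ω) r = c r} → Pr F ≠ 0 →
        (Pr[next 0 | F]).toReal = nggpWeight α σ (m + 1) (k + 1) / nggpWeight α σ m k ∧
        ∀ r : ℕ, 1 ≤ r → r ≤ m →
          (Pr[next r | F]).toReal =
            ((r : ℝ) - σ) * c r * (nggpWeight α σ (m + 1) k / nggpWeight α σ m k)) := by
  subst hdata hnext
  have hdm : Measurable fun ω (i : Fin m) => X i.castSucc ω :=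
    measurable_pi_lambda _ fun i => hX.measurable _
  have hN : ∀ r, MeasurableSet
      {ω | X (Fin.last m) ω ∈ symbolsOfFreq (fun i : Fin m => X i.castSucc ω) r} := fun r =>
    measurableSet_eq_fun (measurable_symbolFreq.comp (hdm.prodMk (hX.measurable _)))
      measurable_const
  have hjoint : ∀ r S, MeasurableSet S → _ := fun r S hS =>
    measure_data_inter_next hα hσ0 hσ1 hP hm hX r (S := S) hS
  have hcond := fun r => condExp_indicator_ae_eq_comp hdm (hN r)
    (measurable_predictiveProb α σ r) (predictiveProb_nonneg hα hσ1 hm r) (hjoint r)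
  refine ⟨?_, fun r hr _ => ?_, ?_⟩
  · simpa only [predictiveProb, if_true] using hcond 0
  · have hr0 : r ≠ 0 := by omega
    simpa only [predictiveProb, hr0, if_false] using hcond r
  · rintro c k F hk rfl hF
    have hS : MeasurableSet {x : Fin m → V | ∀ r ∈ Finset.Icc 1 m, freqCount x r = c r} := by
      simp only [Set.ofPred_forall]
      exact MeasurableSet.iInter fun r => MeasurableSet.iInter fun hr =>
        measurableSet_eq_fun (measurable_freqCount (Finset.mem_Icc.1 hr).1) measurable_const
    have hK : ∀ x ∈ {x : Fin m → V | ∀ r ∈ Finset.Icc 1 m, freqCount x r = c r},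
        numDistinct x = k := fun x hx => by
      rw [numDistinct_eq_sum_freqCount, hk]
      exact Finset.sum_congr rfl hx
    have h1 := fun j => nggpWeight_nonneg hα.le σ hm j
    have h2 := fun j => nggpWeight_nonneg hα.le σ (Nat.le_add_left 1 m) j
    refine ⟨?_, fun r hr hrm => ?_⟩
    · refine cond_toReal_eq_of_const hdm hS (hjoint 0 _ hS) hF (div_nonneg (h2 _) (h1 _))
        fun x hx => ?_
      rw [predictiveProb, if_pos rfl, hK x hx]
    · have hr' : (1 : ℝ) ≤ r := by exact_mod_cast hr
      refine cond_toReal_eq_of_const hdm hS (hjoint r _ hS) hF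
        (mul_nonneg (mul_nonneg (by linarith) (by positivity)) (div_nonneg (h2 _) (h1 _)))
        fun x hx => ?_
      rw [predictiveProb, if_neg (by omega), hK x hx, hx r (Finset.mem_Icc.2 ⟨hr, hrm⟩)]
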